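/- Define rational numbers $B(d_1,\dots,d_n)$ for $n\ge 1$ and integers $d_1,\dots,d_n\ge 0$ by $B(0)=\tfrac18$ and, for every $d\ge0$, $n\ge 0$ and $d_1,\dots,d_n\ge0$ with $(d,n)\neq(0,0)$, the recursion $$B(d,d_1,\dots,d_n)=\sum_{i=1}^n(2d_i+1)\,B(d_1,\dots,d_i+d,\dots,d_n)+\frac12\sum_{\substack{a,b\ge0\\ a+b=d-1}}\Bigl(B(a,b,d_1,\dots,d_n)+\sum_{I\sqcup J=\{1,\dots,n\}}B\bigl(a,(d_i)_{i\in I}\bigr)\,B\bigl(b,(d_j)_{j\in J}\bigr)\Bigr),$$ where the last sum is over all ordered pairs $(I,J)$ of complementary subsets; these relations determine $B$ uniquely, by induction on $\sum_j(2d_j+1)$. For $\mathbf d=(d_1,\dots,d_n)\in(\mathbb Z_{\ge0})^n$, $n\ge1$, put $g(\mathbf d)=d_1+\cdots+d_n+1$ and $X(\mathbf d)=\sum_{j=1}^n(2d_j+1)$. The Brézin–Gross–Witten (BGW) numbers are $$\langle\tau_{d_1}\cdots\tau_{d_n}\rangle^{\Theta}_{g(\mathbf d)}=\frac{B(d_1,\dots,d_n)}{\prod_{j=1}^n(2d_j+1)!!},$$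 and the normalized BGW numbers are $$C(\mathbf d)=\frac{2^{2g(\mathbf d)-1}\prod_{j=1}^n(2d_j+1)!!}{(X(\mathbf d)-1)!}\,\langle\tau_{d_1}\cdots\tau_{d_n}\rangle^{\Theta}_{g(\mathbf d)}.$$ Theorem. One has $C(\mathbf d)=\frac1\pi+O\bigl(\frac1{g(\mathbf d)}\bigr)$ uniformly in $n$ and $\mathbf d$; that is, there is an absolute constant $K$ such that $$\Bigl|C(\mathbf d)-\frac1\pi\Bigr|\le\frac{K}{g(\mathbf d)}\qquad\text{for all } n\ge1 \text{ and all } \mathbf d\in(\mathbb Z_{\ge0})^n.$$ -/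

import Mathlib

namespace BGW

open scoped Nat

/-- `X(d₁,…,dₙ) = ∑ (2 dⱼ + 1)` for a finite sequence given as a list. -/
def weight (l : List ℕ) : ℕ := (l.map fun d => 2 * d + 1).sum

/-- The subsequence `(dᵢ)_{i ∈ I}` of `ds`, in increasing order of the indices. -/
def subseq (ds : List ℕ) (I : Finset (Fin ds.length)) : List ℕ :=
  ((List.finRange ds.length).filter fun i => i ∈ I).map ds.get

theorem weight_subseq_le (ds : List ℕ) (I : Finset (Fin ds.length)) :
    weight (subseq ds I) ≤ weight ds := by
  have h : (subseq ds I).Sublist ds := by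
    have h1 : ((List.finRange ds.length).filter fun i => i ∈ I).Sublist
        (List.finRange ds.length) := List.filter_sublist
    have h2 := h1.map ds.get
    rwa [List.map_get_finRange] at h2
  exact (h.map _).sum_le_sum (fun _ _ => Nat.zero_le _)

theorem weight_set (ds : List ℕ) (i : Fin ds.length) (d : ℕ) :
    weight (ds.set i (ds.get i + d)) = weight ds + 2 * d := by
  induction ds with
  | nil => exact i.elim0
  | cons x xs ih =>
    refine Fin.cases ?_ (fun j => ?_) i
    · simp [weight]; ring
    · have := ih j
      simp [weight] at this ⊢
      omega

/-- The numbers `B(d₁,…,dₙ) = ⟨τ_{d₁} ⋯ τ_{dₙ}⟩^Θ ∏ (2 dⱼ + 1)!!`, computed from `B(0) = 1/8` by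
the recursion
`B(d, d₁,…,dₙ) = ∑ᵢ (2 dᵢ + 1) B(d₁,…,dᵢ + d,…,dₙ)
  + ½ ∑_{a+b=d-1} (B(a, b, d₁,…,dₙ) + ∑_{I ⊔ J = {1,…,n}} B(a, d_I) B(b, d_J))`
(equivalent to the Virasoro constraints on the partition function), which is used for all
`(d, d₁,…,dₙ)` other than the one-term sequence `(0)`.
The pairs `(a, b)` are written as `(a, d - 1 - a)` with `a < d`, and `J` is the complement of `I`.
The empty sequence never occurs in the recursion; its value is a convention. -/
def B : List ℕ → ℚ
  | [] => 0
  | d :: ds =>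
    if d = 0 ∧ ds = [] then 1 / 8
    else
      (∑ i : Fin ds.length, (2 * (ds.get i : ℚ) + 1) * B (ds.set i (ds.get i + d)))
      + 1 / 2 * ∑ a : Fin d,
          (B ((a : ℕ) :: (d - 1 - (a : ℕ)) :: ds)
            + ∑ I : Finset (Fin ds.length),
                B ((a : ℕ) :: subseq ds I) * B ((d - 1 - (a : ℕ)) :: subseq ds Iᶜ))
termination_by l => weight l
decreasing_by
  · rw [weight_set]; simp [weight]; omega
  · have := a.isLt
    simp [weight]; omega
  · have := a.isLt
    have := weight_subseq_le ds I
    simp [weight] at this ⊢; omega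
  · have := a.isLt
    have := weight_subseq_le ds Iᶜ
    simp [weight] at this ⊢; omega

variable {n : ℕ}

/-- The genus `g(d) = d₁ + ⋯ + dₙ + 1`. -/
def genus (d : Fin n → ℕ) : ℕ := ∑ j, d j + 1

/-- `X(d) = ∑ⱼ (2 dⱼ + 1)`. -/
def X (d : Fin n → ℕ) : ℕ := ∑ j, (2 * d j + 1)

/-- The Brézin–Gross–Witten number `⟨τ_{d₁} ⋯ τ_{dₙ}⟩^Θ_{g(d)}` (for `n ≥ 1`). -/
def bgwNumber (d : Fin n → ℕ) : ℚ :=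
  B (List.ofFn d) / ∏ j, (((2 * d j + 1)‼ : ℕ) : ℚ)

/-- The normalized BGW number `C(d)` (for `n ≥ 1`, so that `X(d) ≥ 1`). -/
def C (d : Fin n → ℕ) : ℚ :=
  2 ^ (2 * genus d - 1) * (∏ j, (((2 * d j + 1)‼ : ℕ) : ℚ)) / (((X d - 1)! : ℕ) : ℚ) * bgwNumber d

end BGW

/-!
The recursion for `B` is a family of Virasoro constraints on the partition function, which is the
exponential of the generating series of `B` in the shuffle algebra. Since the Virasoro operators
satisfy the Witt commutation relations, `B` is symmetric although the recursion singles out one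
index.

The partition function is also a linear functional on polynomials in the odd power sums. On
products `h_i h_j` of complete symmetric functions the constraints close up, and give values
expressed through the coefficients of the Bessel series `y`. Newton's identity recovers the power
sums from these products, so that the numbers `B(k)` are read off from `y(x) y(-x)`, which
satisfies a third-order differential equation. The resulting first-order recursion for the
normalized one-point numbers is that of Wallis' product, whence the limit `1 / π`.

For several indices, apply the recursion to the smallest index `d`, which may be taken positive. Up
to a quadratic term, it says that the normalized number is a weighted average: the terms
`(…, dᵢ + d, …)` have one index fewer, and the terms `(a, d - 1 - a, …)`, of total weight at most
`1 / n`, have one index more but smaller sum. If `m` is the sum of the indices, then the quadratic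
term changes the average by `O(1 / m²)`, and an induction on the weight yields an error bound
`O(1 / m)`, uniformly in the number `n` of indices.
-/

/-! ### The shuffle algebra -/

/-- The shuffle algebra: functions on words in the alphabet `α`, multiplied by
`(f g)(w) = ∑ f(w_I) g(w_J)` over all splittings of `w` into complementary subwords. If `α` indexes
variables `t_a`, then `f` encodes the formal power series whose derivative in the variables
`t_{a₁}, …, t_{aₙ}` at the origin is `f [a₁, …, aₙ]`. -/
def ShuffleAlgebra (α R : Type*) : Type _ := List α → R

namespace ShuffleAlgebra

variable {α R : Type*} [CommRing R]

/-- The shuffle product, by recursion on the word: its first letter goes to either factor. -/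
def shuffle : List α → (List α → R) → (List α → R) → R
  | [], f, g => f [] * g []
  | s :: w, f, g => shuffle w (fun t => f (s :: t)) g + shuffle w f (fun t => g (s :: t))

theorem shuffle_comm (w : List α) (f g : List α → R) : shuffle w f g = shuffle w g f := by
  induction w generalizing f g with
  | nil => exact mul_comm _ _
  | cons s w ih =>
    exact (add_comm _ _).trans (congrArg₂ (· + ·) (ih _ _) (ih _ _))

theorem shuffle_add_left (w : List α) (f g k : List α → R) :
    shuffle w (fun t => f t + g t) k = shuffle w f k + shuffle w g k := by
  induction w generalizing f g k with
  | nil => exact add_mul _ _ _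
  | cons s w ih => simp only [shuffle, ih]; ring

theorem shuffle_smul_left (w : List α) (c : R) (f g : List α → R) :
    shuffle w (fun t => c * f t) g = c * shuffle w f g := by
  induction w generalizing f g with
  | nil => exact mul_assoc _ _ _
  | cons s w ih => simp only [shuffle, ih, mul_add]

theorem shuffle_add_right (w : List α) (f g k : List α → R) :
    shuffle w f (fun t => g t + k t) = shuffle w f g + shuffle w f k := by
  simp only [shuffle_comm w f, shuffle_add_left]

theorem shuffle_zero_left (w : List α) (f : List α → R) : shuffle w (fun _ => 0) f = 0 := by
  simpa only [zero_mul] using shuffle_smul_left w 0 (fun _ => 0) f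

theorem shuffle_assoc (w : List α) (f g k : List α → R) :
    shuffle w (fun t => shuffle t f g) k = shuffle w f (fun t => shuffle t g k) := by
  induction w generalizing f g k with
  | nil => exact mul_assoc _ _ _
  | cons s w ih => simp only [shuffle, shuffle_add_left, shuffle_add_right, ih, add_assoc]

theorem shuffle_congr_right {w : List α} (f : List α → R) {g g' : List α → R}
    (h : ∀ t : List α, t.length ≤ w.length → g t = g' t) : shuffle w f g = shuffle w f g' := by
  induction w generalizing f g g' with
  | nil => rw [shuffle, shuffle, h [] le_rfl]
  | cons s w ih =>
    rw [shuffle, shuffle, ih _ fun t ht => h t (ht.trans (Nat.le_succ _)),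
      ih f fun t ht => h (s :: t) (Nat.succ_le_succ ht)]

instance instAddCommGroup : AddCommGroup (ShuffleAlgebra α R) :=
  inferInstanceAs (AddCommGroup (List α → R))

instance instModule : Module R (ShuffleAlgebra α R) := inferInstanceAs (Module R (List α → R))

instance : One (ShuffleAlgebra α R) := ⟨fun w => if w = [] then 1 else 0⟩

instance : Mul (ShuffleAlgebra α R) := ⟨fun f g w => shuffle w f g⟩

theorem shuffle_one_left (w : List α) (f : List α → R) :
    shuffle w (fun t => if t = [] then 1 else 0) f = f w := by
  induction w generalizing f with
  | nil => rw [shuffle, if_pos rfl, one_mul]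
  | cons s w ih =>
    simp only [shuffle, List.cons_ne_nil, if_false, shuffle_zero_left, zero_add, ih]

instance instCommRing : CommRing (ShuffleAlgebra α R) :=
  { instAddCommGroup with
    mul := (· * ·)
    one := 1
    mul_comm f g := funext fun w => shuffle_comm w f g
    mul_assoc f g k := funext fun w => shuffle_assoc w f g k
    one_mul f := funext fun w => shuffle_one_left w f
    mul_one f := funext fun w => (shuffle_comm w f _).trans (shuffle_one_left w f)
    zero_mul f := funext fun w => shuffle_zero_left w f
    mul_zero f := funext fun w => (shuffle_comm w f _).trans (shuffle_zero_left w f)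
    right_distrib f g k := funext fun w => shuffle_add_left w f g k
    left_distrib f g k := funext fun w => shuffle_add_right w f g k }

instance instAlgebra : Algebra R (ShuffleAlgebra α R) :=
  Algebra.ofModule (fun c f g => funext fun w => shuffle_smul_left w c f g)
    fun c f g => funext fun w => (shuffle_comm w f _).trans <|
      (shuffle_smul_left w c g f).trans <| congrArg (c * ·) (shuffle_comm w g f)

/-- The value at the word `w`, that is, the coefficient of the corresponding divided monomial. -/
def coeff (w : List α) : ShuffleAlgebra α R →ₗ[R] R := LinearMap.proj w

/-- The element of the shuffle algebra with prescribed coefficients. -/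
def mk (f : List α → R) : ShuffleAlgebra α R := f

theorem coeff_mk (w : List α) (f : List α → R) : coeff w (mk f) = f w := rfl

theorem coeff_mul (w : List α) (f g : ShuffleAlgebra α R) :
    coeff w (f * g) = shuffle w (fun t => coeff t f) (fun t => coeff t g) :=
  rfl

theorem coeff_nil_mul (f g : ShuffleAlgebra α R) :
    coeff [] (f * g) = coeff [] f * coeff [] g :=
  rfl

theorem coeff_one (w : List α) :
    coeff w (1 : ShuffleAlgebra α R) = if w = [] then 1 else 0 :=
  rfl

theorem ext_coeff {f g : ShuffleAlgebra α R} (h : ∀ w, coeff w f = coeff w g) : f = g := funext h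

/-- The partial derivative in the variable `t_s`, which prepends the letter `s` to the argument. -/
def pderiv (s : α) : Derivation R (ShuffleAlgebra α R) (ShuffleAlgebra α R) :=
  Derivation.mk'
    { toFun f := mk fun w => coeff (s :: w) f
      map_add' _ _ := rfl
      map_smul' _ _ := rfl }
    fun f g => funext fun w => (add_comm _ _).trans <| congrArg (_ + ·) <|
      shuffle_comm w (fun t => coeff (s :: t) f) g

theorem coeff_cons (s : α) (w : List α) (f : ShuffleAlgebra α R) :
    coeff (s :: w) f = coeff w (pderiv s f) :=
  rfl

theorem pderiv_mul (s : α) (f g : ShuffleAlgebra α R) :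
    pderiv s (f * g) = pderiv s f * g + f * pderiv s g :=
  rfl

section Exp

/-- The recursion for `exp`, with `n` bounding the length of the word. -/
def expAux (f : ShuffleAlgebra α R) : ℕ → List α → R
  | 0, _ => 1
  | _ + 1, [] => 1
  | n + 1, s :: w => shuffle w (fun t => coeff (s :: t) f) (expAux f n)

theorem expAux_eq (f : ShuffleAlgebra α R) {n m : ℕ} {w : List α} (hn : w.length ≤ n)
    (hm : w.length ≤ m) : expAux f n w = expAux f m w := by
  induction n generalizing m w with
  | zero =>
    obtain rfl : w = [] := List.eq_nil_of_length_eq_zero (Nat.le_zero.1 hn)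
    cases m <;> rfl
  | succ n ih =>
    match w, m with
    | [], 0 => rfl
    | [], _ + 1 => rfl
    | s :: w, m + 1 =>
      simp only [List.length_cons, add_le_add_iff_right] at hn hm
      exact shuffle_congr_right _ fun t ht => ih (ht.trans hn) (ht.trans hm)

/-- The exponential of `f - f(0)`: the solution of `∂ₛ F = ∂ₛ f · F` with constant term `1`. -/
def exp (f : ShuffleAlgebra α R) : ShuffleAlgebra α R := mk fun w => expAux f w.length w

theorem coeff_nil_exp (f : ShuffleAlgebra α R) : coeff [] (exp f) = 1 := rfl

theorem pderiv_exp (s : α) (f : ShuffleAlgebra α R) :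
    pderiv s (exp f) = pderiv s f * exp f :=
  ext_coeff fun _ => shuffle_congr_right _ fun _ ht => expAux_eq f ht le_rfl

theorem exp_mul_exp_neg (f : ShuffleAlgebra α R) : exp f * exp (-f) = 1 := by
  refine ext_coeff fun w => ?_
  cases w with
  | nil => rw [coeff_nil_mul, coeff_nil_exp, coeff_nil_exp, mul_one, coeff_one, if_pos rfl]
  | cons s w =>
    rw [coeff_cons, coeff_cons]
    congr 1
    rw [pderiv_mul, pderiv_exp, pderiv_exp, map_neg, Derivation.map_one_eq_zero]
    ring

theorem pderiv_pderiv_exp (s t : α) (f : ShuffleAlgebra α R) :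
    pderiv s (pderiv t (exp f)) = (pderiv s (pderiv t f) + pderiv t f * pderiv s f) * exp f := by
  rw [pderiv_exp, pderiv_mul, pderiv_exp]
  ring

end Exp

section LetterDeriv

variable (c : α → R) (φ : α → α)

/-- The operator underlying `letterDeriv`. -/
def letterMap : ShuffleAlgebra α R →ₗ[R] ShuffleAlgebra α R where
  toFun f := mk fun w => ∑ i : Fin w.length, c (w.get i) * coeff (w.set i (φ (w.get i))) f
  map_add' _ _ := funext fun _ =>
    (Finset.sum_congr rfl fun _ _ => mul_add _ _ _).trans Finset.sum_add_distrib
  map_smul' _ _ := funext fun _ =>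
    (Finset.sum_congr rfl fun _ _ => mul_left_comm _ _ _).trans (Finset.mul_sum _ _ _).symm

theorem coeff_nil_letterMap (f : ShuffleAlgebra α R) : coeff [] (letterMap c φ f) = 0 := rfl

theorem pderiv_letterMap (s : α) (f : ShuffleAlgebra α R) :
    pderiv s (letterMap c φ f) = c s • pderiv (φ s) f + letterMap c φ (pderiv s f) :=
  ext_coeff fun _ => Fin.sum_univ_succ _

theorem letterMap_mul (f g : ShuffleAlgebra α R) :
    letterMap c φ (f * g) = f * letterMap c φ g + g * letterMap c φ f := by
  refine ext_coeff fun w => ?_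
  induction w generalizing f g with
  | nil => simp only [map_add, coeff_nil_mul, coeff_nil_letterMap, mul_zero, add_zero]
  | cons s w ih =>
    have h : pderiv s (f * letterMap c φ g + g * letterMap c φ f) =
        c s • pderiv (φ s) (f * g)
          + (pderiv s f * letterMap c φ g + g * letterMap c φ (pderiv s f)
            + (f * letterMap c φ (pderiv s g) + pderiv s g * letterMap c φ f)) := by
      simp only [map_add, pderiv_mul, pderiv_letterMap, Algebra.smul_def]
      ring
    rw [coeff_cons, coeff_cons, h]
    simp only [pderiv_letterMap, pderiv_mul, map_add, ih]

/-- The derivation `∑ₛ c(s) tₛ ∂/∂t_{φ(s)}`, which replaces each letter `s` in turn by `φ s`,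
with coefficient `c s`. -/
def letterDeriv : Derivation R (ShuffleAlgebra α R) (ShuffleAlgebra α R) :=
  Derivation.mk' (letterMap c φ) (letterMap_mul c φ)

theorem coeff_letterDeriv (w : List α) (f : ShuffleAlgebra α R) :
    coeff w (letterDeriv c φ f) =
      ∑ i : Fin w.length, c (w.get i) * coeff (w.set i (φ (w.get i))) f :=
  rfl

theorem coeff_nil_letterDeriv (f : ShuffleAlgebra α R) : coeff [] (letterDeriv c φ f) = 0 := rfl

theorem pderiv_letterDeriv (s : α) (f : ShuffleAlgebra α R) :
    pderiv s (letterDeriv c φ f) = c s • pderiv (φ s) f + letterDeriv c φ (pderiv s f) :=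
  pderiv_letterMap c φ s f

variable {φ} in
theorem lie_letterDeriv_letterDeriv (c' : α → R) {φ' : α → α} (h : ∀ s, φ (φ' s) = φ' (φ s)) :
    ⁅letterDeriv c φ, letterDeriv c' φ'⁆ =
      letterDeriv (fun s => c s * c' (φ s) - c' s * c (φ' s)) (fun s => φ (φ' s)) := by
  refine Derivation.ext fun f => ext_coeff fun w => ?_
  induction w generalizing f with
  | nil => simp only [Derivation.commutator_apply, map_sub, coeff_nil_letterDeriv, sub_zero]
  | cons s w ih =>
    have ih := ih (pderiv s f)
    simp only [Derivation.commutator_apply, map_sub, h] at ih ⊢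
    simp only [coeff_cons, pderiv_letterDeriv, map_add, Derivation.map_smul, map_smul, smul_eq_mul,
      h]
    linear_combination ih

/-- The difference `Δ` of the two sides satisfies `∂ₛ Δ = ∂ₛ f · Δ`, and `Δ(0) = 0`. -/
theorem letterDeriv_exp (f : ShuffleAlgebra α R) :
    letterDeriv c φ (exp f) = letterDeriv c φ f * exp f := by
  suffices h : ∀ w k, coeff w (k * (letterDeriv c φ (exp f) - letterDeriv c φ f * exp f)) = 0 by
    refine sub_eq_zero.1 (ext_coeff fun w => ?_)
    simpa only [one_mul, map_zero] using h w 1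
  intro w
  induction w with
  | nil =>
    intro k
    simp only [coeff_nil_mul, map_sub, coeff_nil_letterDeriv, zero_mul, sub_zero, mul_zero]
  | cons s w ih =>
    intro k
    have h : pderiv s (k * (letterDeriv c φ (exp f) - letterDeriv c φ f * exp f)) =
        (pderiv s k + k * pderiv s f)
          * (letterDeriv c φ (exp f) - letterDeriv c φ f * exp f) := by
      simp only [map_sub, pderiv_letterDeriv, pderiv_exp, Derivation.leibniz, smul_eq_mul,
        Algebra.smul_def]
      ring
    rw [coeff_cons, h, ih]

end LetterDeriv

section PermInvariant

/-- Symmetric functions of the letters; these correspond to genuine power series, as their partial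
derivatives commute. -/
def PermInvariant (f : ShuffleAlgebra α R) : Prop :=
  ∀ ⦃w w' : List α⦄, w.Perm w' → coeff w f = coeff w' f

protected theorem PermInvariant.pderiv {f : ShuffleAlgebra α R} (hf : PermInvariant f) (s : α) :
    PermInvariant (pderiv s f) :=
  fun _ _ h => hf (h.cons s)

theorem PermInvariant.pderiv_comm {f : ShuffleAlgebra α R} (hf : PermInvariant f) (s t : α) :
    pderiv s (pderiv t f) = pderiv t (pderiv s f) :=
  ext_coeff fun w => hf (List.Perm.swap s t w)

open Submodule in
/-- A coinduction principle for symmetry. -/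
theorem permInvariant_of_pderiv_mem_span {P : Set (ShuffleAlgebra α R)}
    (hP : ∀ f ∈ P, ∀ s, pderiv s f ∈ span R P)
    (hcomm : ∀ f ∈ P, ∀ s t, pderiv s (pderiv t f) = pderiv t (pderiv s f))
    {f : ShuffleAlgebra α R} (hf : f ∈ P) : PermInvariant f := by
  have hP' (s : α) : span R P ≤ (span R P).comap (pderiv s).toLinearMap :=
    span_le.2 fun f hf => hP f hf s
  have hcomm' (s t : α) : ∀ f ∈ span R P, pderiv s (pderiv t f) = pderiv t (pderiv s f) := by
    intro f hf
    induction hf using span_induction with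
    | mem f hf => exact hcomm f hf s t
    | zero => simp only [map_zero]
    | add f g _ _ hf hg => simp only [map_add, hf, hg]
    | smul a f _ hf => simp only [Derivation.map_smul, hf]
  suffices h : ∀ w w' : List α, w.Perm w' → ∀ f ∈ span R P, coeff w f = coeff w' f from
    fun w w' hw => h w w' hw f (subset_span hf)
  intro w w' h
  induction h with
  | nil => exact fun _ _ => rfl
  | cons s _ ih => exact fun f hf => ih _ (hP' s hf)
  | swap s t w => exact fun f hf => congrArg (coeff w) (hcomm' s t f hf)
  | trans _ _ ih₁ ih₂ => exact fun f hf => (ih₁ f hf).trans (ih₂ f hf)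

protected theorem PermInvariant.mul {f g : ShuffleAlgebra α R} (hf : PermInvariant f)
    (hg : PermInvariant g) : PermInvariant (f * g) := by
  refine permInvariant_of_pderiv_mem_span
    (P := {h | ∃ f g, PermInvariant f ∧ PermInvariant g ∧ f * g = h}) ?_ ?_ ⟨f, g, hf, hg, rfl⟩
  · rintro _ ⟨f, g, hf, hg, rfl⟩ s
    exact add_mem (Submodule.subset_span ⟨_, _, hf.pderiv s, hg, rfl⟩)
      (Submodule.subset_span ⟨_, _, hf, hg.pderiv s, rfl⟩)
  · rintro _ ⟨f, g, hf, hg, rfl⟩ s t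
    simp only [pderiv_mul, map_add, hf.pderiv_comm s t, hg.pderiv_comm s t]
    ring

protected theorem PermInvariant.letterDeriv {f : ShuffleAlgebra α R} (hf : PermInvariant f)
    (c : α → R) (φ : α → α) : PermInvariant (letterDeriv c φ f) := by
  refine permInvariant_of_pderiv_mem_span
    (P := {h | ∃ f, PermInvariant f ∧ (h = f ∨ h = letterDeriv c φ f)}) ?_ ?_
    ⟨f, hf, Or.inr rfl⟩
  · rintro _ ⟨f, hf, rfl | rfl⟩ s
    · exact Submodule.subset_span ⟨_, hf.pderiv s, Or.inl rfl⟩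
    · rw [pderiv_letterDeriv]
      exact add_mem
        (Submodule.smul_mem _ _ (Submodule.subset_span ⟨_, hf.pderiv _, Or.inl rfl⟩))
        (Submodule.subset_span ⟨_, hf.pderiv s, Or.inr rfl⟩)
  · rintro _ ⟨f, hf, rfl | rfl⟩ s t
    · exact hf.pderiv_comm s t
    · simp only [pderiv_letterDeriv, map_add, Derivation.map_smul, hf.pderiv_comm s,
        hf.pderiv_comm t (φ s)]
      abel

/-- The powers `v ^ n` are included because `∂ₛ v = -∂ₛ u · v ^ 2`. -/
theorem PermInvariant.mul_pow_of_mul_eq_one {u v k : ShuffleAlgebra α R} (hu : PermInvariant u)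
    (huv : u * v = 1) (hk : PermInvariant k) (n : ℕ) : PermInvariant (k * v ^ n) := by
  have hv (s : α) : pderiv s v = -(pderiv s u * v ^ 2) := by
    have h := congrArg (pderiv s) huv
    rw [pderiv_mul, Derivation.map_one_eq_zero] at h
    linear_combination v * h - pderiv s v * huv
  have hpow (k : ShuffleAlgebra α R) (n : ℕ) (s : α) :
      pderiv s (k * v ^ n) = pderiv s k * v ^ n
        - n • (k * pderiv s u * v ^ (n + 1)) := by
    rw [pderiv_mul, Derivation.leibniz_pow, hv, nsmul_eq_mul, nsmul_eq_mul, smul_eq_mul]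
    cases n with
    | zero => simp only [Nat.cast_zero, zero_mul, mul_zero, add_zero, sub_zero]
    | succ n => rw [Nat.add_sub_cancel]; ring
  refine permInvariant_of_pderiv_mem_span
    (P := {h | ∃ k, PermInvariant k ∧ ∃ n, k * v ^ n = h}) ?_ ?_ ⟨k, hk, n, rfl⟩
  · rintro _ ⟨k, hk, n, rfl⟩ s
    rw [hpow]
    refine sub_mem (Submodule.subset_span ⟨_, hk.pderiv s, n, rfl⟩)
      (Submodule.smul_of_tower_mem _ n (Submodule.subset_span ?_))
    exact ⟨k * pderiv s u, hk.mul (hu.pderiv s), n + 1, rfl⟩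
  · rintro _ ⟨k, hk, n, rfl⟩ s t
    simp only [hpow, map_sub, map_nsmul, pderiv_mul, hk.pderiv_comm s t, hu.pderiv_comm s t]
    simp only [nsmul_eq_mul]
    ring

theorem PermInvariant.of_exp {f : ShuffleAlgebra α R} (hf : PermInvariant (exp f)) :
    PermInvariant f := by
  have hdf (s : α) : pderiv s (exp f) * exp (-f) ^ 1 = pderiv s f := by
    rw [pderiv_exp, pow_one, mul_assoc, exp_mul_exp_neg, mul_one]
  have htail (s : α) : PermInvariant (pderiv s f) :=
    hdf s ▸ hf.mul_pow_of_mul_eq_one (exp_mul_exp_neg f) (hf.pderiv s) 1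
  have hcomm (s t : α) : pderiv s (pderiv t f) = pderiv t (pderiv s f) := by
    have h := hf.pderiv_comm s t
    rw [pderiv_pderiv_exp, pderiv_pderiv_exp] at h
    linear_combination exp (-f) * h - (pderiv s (pderiv t f)
      - pderiv t (pderiv s f)) * exp_mul_exp_neg f
  intro w w' h
  induction h with
  | nil => rfl
  | cons s h _ => exact htail s h
  | swap s t w => exact congrArg (coeff w) (hcomm s t)
  | trans _ _ ih₁ ih₂ => exact ih₁.trans ih₂

end PermInvariant

end ShuffleAlgebra

/-! ### Permutation invariance of the numbers `B` -/

namespace BGW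

open ShuffleAlgebra

theorem sum_finset_fin_succ {M : Type*} [AddCommMonoid M] {n : ℕ} (F : Finset (Fin (n + 1)) → M) :
    ∑ I, F I = ∑ I : Finset (Fin n), F (insert 0 (I.map (Fin.succEmb n)))
      + ∑ I : Finset (Fin n), F (I.map (Fin.succEmb n)) := by
  have h0 : (0 : Fin (n + 1)) ∉ Finset.univ.map (Fin.succEmb n) := by
    simp only [Finset.mem_map, Fin.coe_succEmb, Fin.succ_ne_zero, and_false, exists_false,
      not_false_eq_true]
  have huniv : (Finset.univ : Finset (Fin (n + 1))) =
      insert 0 (Finset.univ.map (Fin.succEmb n)) := by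
    rw [Fin.univ_succ, Finset.cons_eq_insert]
    rfl
  have hpow : (Finset.univ.map (Fin.succEmb n)).powerset =
      Finset.univ.map (Finset.mapEmbedding (Fin.succEmb n)).toEmbedding := by
    ext J
    simp only [Finset.mem_powerset, Finset.subset_map_iff, Finset.mem_map, Finset.mem_univ,
      Finset.subset_univ, true_and, eq_comm (a := J)]
    rfl
  rw [← Finset.powerset_univ, huniv, Finset.sum_powerset_insert h0, hpow, Finset.sum_map,
    Finset.sum_map, add_comm]
  rfl

theorem subseq_cons_insert (s : ℕ) (l : List ℕ) (I : Finset (Fin l.length)) :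
    subseq (s :: l) (insert 0 (I.map (Fin.succEmb l.length))) = s :: subseq l I := by
  simp only [subseq, List.length_cons, List.finRange_succ]
  rw [List.filter_cons_of_pos (by simp), List.map_cons, List.filter_map, List.map_map]
  congr 2
  refine congrArg (fun p => List.filter p (List.finRange l.length)) (funext fun i => ?_)
  simp [Fin.succ_ne_zero]

theorem subseq_cons_map (s : ℕ) (l : List ℕ) (I : Finset (Fin l.length)) :
    subseq (s :: l) (I.map (Fin.succEmb l.length)) = subseq l I := by
  simp only [subseq, List.length_cons, List.finRange_succ]
  rw [List.filter_cons_of_neg (by simp), List.filter_map, List.map_map]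
  congr 1
  refine congrArg (fun p => List.filter p (List.finRange l.length)) (funext fun i => ?_)
  simp

theorem compl_map_succ {n : ℕ} (I : Finset (Fin n)) :
    (I.map (Fin.succEmb n))ᶜ = insert 0 (Iᶜ.map (Fin.succEmb n)) := by
  ext i
  refine Fin.cases ?_ (fun j => ?_) i <;> simp

theorem compl_insert_zero {n : ℕ} (I : Finset (Fin n)) :
    (insert 0 (I.map (Fin.succEmb n)))ᶜ = Iᶜ.map (Fin.succEmb n) := by
  rw [eq_comm, ← compl_compl (Iᶜ.map _), compl_map_succ, compl_compl]

theorem shuffle_eq_sum_subseq {R : Type*} [CommRing R] (l : List ℕ) (f g : List ℕ → R) :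
    shuffle l f g = ∑ I : Finset (Fin l.length), f (subseq l I) * g (subseq l Iᶜ) := by
  induction l generalizing f g with
  | nil => simp [shuffle, subseq]
  | cons s l ih =>
    refine Eq.trans ?_ (sum_finset_fin_succ (n := l.length) _).symm
    rw [shuffle, ih, ih]
    refine congrArg₂ (· + ·) (Finset.sum_congr rfl fun I _ => ?_)
      (Finset.sum_congr rfl fun I _ => ?_)
    · rw [subseq_cons_insert, compl_insert_zero, subseq_cons_map]
    · rw [subseq_cons_map, compl_map_succ, subseq_cons_insert]

theorem weight_cons (s : ℕ) (l : List ℕ) : weight (s :: l) = 2 * s + 1 + weight l := by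
  rw [weight, List.map_cons, List.sum_cons, weight]

theorem weight_perm {l l' : List ℕ} (h : l.Perm l') : weight l = weight l' :=
  (h.map _).sum_eq

/-- The vector field `∑ₖ (2k+1) tₖ ∂/∂t_{k+d}`. -/
def virasoroField (d : ℕ) : Derivation ℚ (ShuffleAlgebra ℕ ℚ) (ShuffleAlgebra ℕ ℚ) :=
  letterDeriv (fun k => 2 * k + 1) (· + d)

/-- The second-order operator `∑_{a+b=d-1} ∂²/∂t_a ∂t_b`. -/
def virasoroLaplacian (d : ℕ) : ShuffleAlgebra ℕ ℚ →ₗ[ℚ] ShuffleAlgebra ℕ ℚ :=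
  ∑ a ∈ Finset.range d, (pderiv (d - 1 - a)).toLinearMap ∘ₗ (pderiv a).toLinearMap

/-- The constant term of the Virasoro operators, coming from `B(0) = 1/8`. -/
def anomaly (d : ℕ) : ℚ := if d = 0 then 1 / 8 else 0

/-- The Virasoro operator, in the normalization in which the constraint on the partition function
`Z` is `∂Z/∂t_d = virasoro d Z`. -/
def virasoro (d : ℕ) : ShuffleAlgebra ℕ ℚ →ₗ[ℚ] ShuffleAlgebra ℕ ℚ :=
  (virasoroField d).toLinearMap + (1 / 2 : ℚ) • virasoroLaplacian d + anomaly d • LinearMap.id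

theorem virasoroLaplacian_apply (d : ℕ) (f : ShuffleAlgebra ℕ ℚ) :
    virasoroLaplacian d f = ∑ a ∈ Finset.range d, pderiv (d - 1 - a) (pderiv a f) := by
  rw [virasoroLaplacian, LinearMap.sum_apply]
  rfl

theorem virasoro_apply (d : ℕ) (f : ShuffleAlgebra ℕ ℚ) :
    virasoro d f = virasoroField d f + (1 / 2 : ℚ) • virasoroLaplacian d f + anomaly d • f :=
  rfl

theorem coeff_virasoroField (d : ℕ) (l : List ℕ) (f : ShuffleAlgebra ℕ ℚ) :
    coeff l (virasoroField d f) =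
      ∑ i : Fin l.length, (2 * (l.get i : ℚ) + 1) * coeff (l.set i (l.get i + d)) f :=
  coeff_letterDeriv _ _ l f

theorem pderiv_virasoroField (e d : ℕ) (f : ShuffleAlgebra ℕ ℚ) :
    pderiv e (virasoroField d f) =
      (2 * e + 1 : ℚ) • pderiv (e + d) f + virasoroField d (pderiv e f) :=
  pderiv_letterDeriv _ _ e f

theorem coeff_virasoro (d : ℕ) (l : List ℕ) (f : ShuffleAlgebra ℕ ℚ) :
    coeff l (virasoro d f) =
      ∑ i : Fin l.length, (2 * (l.get i : ℚ) + 1) * coeff (l.set i (l.get i + d)) f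
      + 1 / 2 * ∑ a ∈ Finset.range d, coeff (a :: (d - 1 - a) :: l) f + anomaly d * coeff l f := by
  simp only [virasoro_apply, virasoroLaplacian_apply, map_add, map_smul, map_sum, smul_eq_mul,
    coeff_virasoroField, coeff_cons]

theorem coeff_virasoro_congr {d : ℕ} {l : List ℕ} {f g : ShuffleAlgebra ℕ ℚ}
    (h : ∀ t, weight t = weight l + 2 * d → coeff t f = coeff t g) :
    coeff l (virasoro d f) = coeff l (virasoro d g) := by
  rw [coeff_virasoro, coeff_virasoro]
  congr 1
  · congr 1
    · exact Finset.sum_congr rfl fun i _ => by rw [h _ (weight_set l i d)]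
    · congr 1
      refine Finset.sum_congr rfl fun a ha => h _ ?_
      have := Finset.mem_range.1 ha
      simp only [weight_cons]
      omega
  · by_cases hd : d = 0
    · rw [h l (by rw [hd, mul_zero, add_zero])]
    · rw [anomaly, if_neg hd, zero_mul, zero_mul]

theorem permInvariant_virasoro {f : ShuffleAlgebra ℕ ℚ} (hf : PermInvariant f) (d : ℕ) :
    PermInvariant (virasoro d f) := by
  intro l l' h
  have hfield : coeff l (virasoroField d f) = coeff l' (virasoroField d f) :=
    hf.letterDeriv _ _ h
  simp only [virasoro_apply, virasoroLaplacian_apply, map_add, map_smul, map_sum, hfield,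
    ((hf.pderiv _).pderiv _) h, hf h]

theorem lie_virasoroField (d e : ℕ) :
    ⁅virasoroField d, virasoroField e⁆ = (2 * (d - e) : ℚ) • virasoroField (d + e) := by
  refine (lie_letterDeriv_letterDeriv _ _ fun s => add_right_comm s e d).trans ?_
  refine Derivation.ext fun f => ext_coeff fun l => ?_
  simp only [Derivation.smul_apply, map_smul, coeff_virasoroField, coeff_letterDeriv, smul_eq_mul,
    Finset.mul_sum]
  refine Finset.sum_congr rfl fun i _ => ?_
  rw [add_assoc, add_comm e d]
  push_cast
  ring

theorem sum_range_two_mul_add_one_smul {M : Type*} [AddCommGroup M] [Module ℚ M] {n : ℕ}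
    {G : ℕ → M} (hG : ∀ a < n, G (n - 1 - a) = G a) :
    ∑ a ∈ Finset.range n, (2 * a + 1 : ℚ) • G a = (n : ℚ) • ∑ a ∈ Finset.range n, G a := by
  have hreflect : ∑ a ∈ Finset.range n, (2 * a + 1 : ℚ) • G a =
      ∑ a ∈ Finset.range n, (2 * n - (2 * a + 1) : ℚ) • G a := by
    rw [← Finset.sum_range_reflect]
    refine Finset.sum_congr rfl fun a ha => ?_
    have ha := Finset.mem_range.1 ha
    rw [hG a ha, Nat.sub_sub, Nat.cast_sub (by omega)]
    congr 1
    push_cast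
    ring
  simp only [sub_smul, Finset.sum_sub_distrib, ← Finset.smul_sum] at hreflect
  have htwo : (2 : ℚ) • ∑ a ∈ Finset.range n, (2 * a + 1 : ℚ) • G a =
      (2 : ℚ) • ((n : ℚ) • ∑ a ∈ Finset.range n, G a) := by
    rw [two_smul, ← mul_smul]
    exact eq_sub_iff_add_eq.1 hreflect
  exact smul_right_injective M two_ne_zero htwo

theorem virasoroLaplacian_virasoroField {f : ShuffleAlgebra ℕ ℚ} (hf : PermInvariant f)
    (d e : ℕ) :
    virasoroLaplacian e (virasoroField d f) = virasoroField d (virasoroLaplacian e f)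
      + (2 : ℚ) • ∑ a ∈ Finset.range e,
          (2 * a + 1 : ℚ) • pderiv (e - 1 - a) (pderiv (a + d) f) := by
  have hreflect : ∑ a ∈ Finset.range e,
        (2 * (e - 1 - a : ℕ) + 1 : ℚ) • pderiv (e - 1 - a + d) (pderiv a f) =
      ∑ a ∈ Finset.range e, (2 * a + 1 : ℚ) • pderiv (e - 1 - a) (pderiv (a + d) f) := by
    rw [← Finset.sum_range_reflect]
    refine Finset.sum_congr rfl fun a ha => ?_
    have ha := Finset.mem_range.1 ha
    rw [show e - 1 - (e - 1 - a) = a by omega, hf.pderiv_comm]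
  simp only [virasoroLaplacian_apply, pderiv_virasoroField, map_add, map_sum, Derivation.map_smul,
    Finset.sum_add_distrib, hreflect]
  rw [two_smul]
  abel

theorem virasoroLaplacian_comm {f : ShuffleAlgebra ℕ ℚ} (hf : PermInvariant f) (d e : ℕ) :
    virasoroLaplacian d (virasoroLaplacian e f) = virasoroLaplacian e (virasoroLaplacian d f) := by
  simp only [virasoroLaplacian_apply, map_sum]
  rw [Finset.sum_comm]
  refine Finset.sum_congr rfl fun a _ => Finset.sum_congr rfl fun b _ => ?_
  exact ext_coeff fun l => hf <|
    List.perm_append_comm_assoc [b, e - 1 - b] [a, d - 1 - a] l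

theorem sum_virasoroLaplacian_commutator {f : ShuffleAlgebra ℕ ℚ} (hf : PermInvariant f)
    (d e : ℕ) :
    ∑ a ∈ Finset.range d, (2 * a + 1 : ℚ) • pderiv (d - 1 - a) (pderiv (a + e) f)
      - ∑ a ∈ Finset.range e, (2 * a + 1 : ℚ) • pderiv (e - 1 - a) (pderiv (a + d) f) =
      (d - e : ℚ) • virasoroLaplacian (d + e) f := by
  set G : ℕ → ShuffleAlgebra ℕ ℚ := fun a => pderiv (e + d - 1 - a) (pderiv a f) with hGdef
  have hG (a : ℕ) (ha : a < e + d) : G (e + d - 1 - a) = G a := by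
    simp only [hGdef]
    rw [show e + d - 1 - (e + d - 1 - a) = a by omega, hf.pderiv_comm]
  have hd : ∑ a ∈ Finset.range d, (2 * a + 1 : ℚ) • pderiv (d - 1 - a) (pderiv (a + e) f) =
      ∑ a ∈ Finset.range d, (2 * (e + a : ℕ) + 1 : ℚ) • G (e + a)
        - (2 * e : ℚ) • ∑ a ∈ Finset.range d, G (e + a) := by
    rw [Finset.smul_sum, ← Finset.sum_sub_distrib]
    refine Finset.sum_congr rfl fun a _ => ?_
    rw [← sub_smul, hGdef, add_comm a e]
    simp only
    rw [show e + d - 1 - (e + a) = d - 1 - a by omega]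
    push_cast
    ring_nf
  have he : ∑ a ∈ Finset.range e, (2 * a + 1 : ℚ) • pderiv (e - 1 - a) (pderiv (a + d) f) =
      (2 * e : ℚ) • ∑ a ∈ Finset.range e, G a
        - ∑ a ∈ Finset.range e, (2 * a + 1 : ℚ) • G a := by
    rw [← Finset.sum_range_reflect, Finset.smul_sum, ← Finset.sum_sub_distrib]
    refine Finset.sum_congr rfl fun a ha => ?_
    have ha := Finset.mem_range.1 ha
    rw [show e - 1 - (e - 1 - a) = a by omega, ← sub_smul, hf.pderiv_comm,
      show e - 1 - a + d = e + d - 1 - a by omega, Nat.sub_sub, Nat.cast_sub (by omega)]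
    congr 1
    push_cast
    ring
  have hsum := sum_range_two_mul_add_one_smul hG
  have hlaplacian : virasoroLaplacian (d + e) f = ∑ a ∈ Finset.range (e + d), G a := by
    rw [virasoroLaplacian_apply, add_comm d e]
  rw [Finset.sum_range_add, Finset.sum_range_add, Nat.cast_add] at hsum
  rw [hd, he, hlaplacian, Finset.sum_range_add]
  linear_combination (norm := module) hsum

theorem virasoro_virasoro_sub {f : ShuffleAlgebra ℕ ℚ} (hf : PermInvariant f) (d e : ℕ) :
    virasoro d (virasoro e f) - virasoro e (virasoro d f) =
      (2 * (d - e) : ℚ) • virasoro (d + e) f := by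
  have hanomaly : (d - e : ℚ) * anomaly (d + e) = 0 := by
    rcases eq_or_ne (d + e) 0 with h | h
    · obtain ⟨rfl, rfl⟩ := Nat.add_eq_zero_iff.1 h
      rw [sub_self, zero_mul]
    · rw [anomaly, if_neg h, mul_zero]
  have hfield := congrArg (fun D => D f) (lie_virasoroField d e)
  simp only [Derivation.commutator_apply, Derivation.smul_apply] at hfield
  have hsum := sum_virasoroLaplacian_commutator hf d e
  have hcomm := virasoroLaplacian_comm hf d e
  have hde := virasoroLaplacian_virasoroField hf d e
  have hed := virasoroLaplacian_virasoroField hf e d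
  simp only [virasoro_apply, map_add, map_smul]
  linear_combination (norm := module) hfield + (1 / 4 : ℚ) • hcomm + hsum
    + (1 / 2 : ℚ) • hed - (1 / 2 : ℚ) • hde - (2 * hanomaly) • f

theorem pderiv_virasoro {f : ShuffleAlgebra ℕ ℚ} (hf : PermInvariant f) (e d : ℕ) :
    pderiv e (virasoro d f) =
      (2 * e + 1 : ℚ) • pderiv (e + d) f + virasoro d (pderiv e f) := by
  have hcomm (a : ℕ) : pderiv e (pderiv (d - 1 - a) (pderiv a f)) =
      pderiv (d - 1 - a) (pderiv a (pderiv e f)) := by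
    rw [(hf.pderiv a).pderiv_comm, hf.pderiv_comm e]
  simp only [virasoro_apply, virasoroLaplacian_apply, map_add, map_sum, Derivation.map_smul,
    pderiv_virasoroField, hcomm, add_assoc]

/-- Truncation below weight `W` makes the induction hypothesis an honest permutation invariance. -/
theorem permInvariant_of_pderiv_eq_virasoro {f : ShuffleAlgebra ℕ ℚ}
    (hf : ∀ d, pderiv d f = virasoro d f) : PermInvariant f := by
  suffices h : ∀ W, ∀ l l' : List ℕ, l.Perm l' → weight l = W → coeff l f = coeff l' f from
    fun l l' hl => h _ l l' hl rfl
  intro W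
  induction W using Nat.strong_induction_on with | _ W ih =>
  let g : ShuffleAlgebra ℕ ℚ := mk fun l => if weight l < W then coeff l f else 0
  have hfg {l : List ℕ} (hl : weight l < W) : coeff l f = coeff l g := (if_pos hl).symm
  have hg : PermInvariant g := by
    intro l l' h
    simp only [g, coeff_mk, ← weight_perm h]
    split_ifs with hl
    · exact ih _ hl l l' h rfl
    · rfl
  have hcons {s : ℕ} {l : List ℕ} (hl : weight (s :: l) ≤ W) :
      coeff (s :: l) f = coeff l (virasoro s g) := by
    rw [weight_cons] at hl
    rw [coeff_cons, hf]
    exact coeff_virasoro_congr fun t ht => hfg (by omega)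
  have hcons₂ {d e : ℕ} {l : List ℕ} (hl : weight (d :: e :: l) = W) :
      coeff (d :: e :: l) f = coeff l ((2 * e + 1 : ℚ) • virasoro (e + d) g
        + virasoro d (virasoro e g)) := by
    simp only [weight_cons] at hl
    rw [hcons (by simp only [weight_cons]; omega), coeff_cons, pderiv_virasoro hg, map_add, map_add,
      map_smul, map_smul, ← coeff_cons, ← hfg (by rw [weight_cons]; omega),
      hcons (by rw [weight_cons]; omega)]
    congr 1
    refine coeff_virasoro_congr fun t ht => ?_
    rw [← coeff_cons, ← hfg (by rw [weight_cons]; omega), hcons (by rw [weight_cons]; omega)]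
  intro l l' h
  induction h with
  | nil => exact fun _ => rfl
  | @cons s l l' h _ =>
    intro hl
    have hl' := weight_perm (h.cons s)
    rw [hcons hl.le, hcons (hl' ▸ hl).le, permInvariant_virasoro hg s h]
  | swap e d l =>
    intro hl
    rw [hcons₂ hl, hcons₂ ((weight_perm (List.Perm.swap d e l)).trans hl)]
    refine congrArg (coeff l) ?_
    rw [add_comm e d]
    linear_combination (norm := module) virasoro_virasoro_sub hg d e
  | trans h _ ih₁ ih₂ => exact fun hl => (ih₁ hl).trans (ih₂ ((weight_perm h).symm.trans hl))

/-- The generating series of the numbers `B`. -/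
def freeEnergy : ShuffleAlgebra ℕ ℚ := mk B

/-- The partition function, i.e. the exponential of the generating series of the numbers `B`. -/
def partitionFunction : ShuffleAlgebra ℕ ℚ := exp freeEnergy

theorem B_nil : B [] = 0 := by rw [B]

theorem B_zero : B [0] = 1 / 8 := by rw [B, if_pos ⟨rfl, rfl⟩]

theorem pderiv_freeEnergy (d : ℕ) :
    pderiv d freeEnergy = virasoro d freeEnergy
      + (1 / 2 : ℚ) • ∑ a ∈ Finset.range d, pderiv a freeEnergy * pderiv (d - 1 - a) freeEnergy
      + anomaly d • (1 - freeEnergy) := by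
  refine ext_coeff fun l => ?_
  simp only [map_add, map_sub, map_smul, map_sum, smul_eq_mul, coeff_virasoro, coeff_mul, coeff_one,
    ← coeff_cons]
  simp only [shuffle_eq_sum_subseq, freeEnergy, coeff_mk]
  by_cases h : d = 0 ∧ l = []
  · obtain ⟨rfl, rfl⟩ := h
    simp [B_zero, B_nil, anomaly]
  · have hanomaly : anomaly d * (if l = [] then 1 else 0) = 0 := by
      rw [anomaly, ite_zero_mul_ite_zero, if_neg h]
    rw [B, if_neg h, ← Fin.sum_univ_eq_sum_range, ← Fin.sum_univ_eq_sum_range,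
      Finset.sum_add_distrib]
    linear_combination -hanomaly

theorem pderiv_partitionFunction (d : ℕ) :
    pderiv d partitionFunction = virasoro d partitionFunction := by
  have hfield : virasoroField d partitionFunction =
      virasoroField d freeEnergy * partitionFunction := letterDeriv_exp _ _ _
  have hlaplacian : virasoroLaplacian d partitionFunction = (virasoroLaplacian d freeEnergy
      + ∑ a ∈ Finset.range d, pderiv a freeEnergy * pderiv (d - 1 - a) freeEnergy)
        * partitionFunction := by
    simp only [virasoroLaplacian_apply, partitionFunction, pderiv_pderiv_exp,
      ← Finset.sum_add_distrib, Finset.sum_mul]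
  rw [virasoro_apply, hfield, hlaplacian, partitionFunction, pderiv_exp, pderiv_freeEnergy,
    virasoro_apply]
  simp only [Algebra.smul_def]
  ring

theorem permInvariant_partitionFunction : PermInvariant partitionFunction :=
  permInvariant_of_pderiv_eq_virasoro pderiv_partitionFunction

theorem permInvariant_freeEnergy : PermInvariant freeEnergy :=
  permInvariant_partitionFunction.of_exp

theorem B_perm {l l' : List ℕ} (h : l.Perm l') : B l = B l' := permInvariant_freeEnergy h

end BGW

/-! ### Two-row evaluations of Virasoro functionals -/

namespace OddPowerSum

open MvPolynomial
open BGW (anomaly)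

/-- The coefficients of `exp (∑ p_k x^(2k+1) / (2k+1))`. -/
noncomputable def completeNat : ℕ → MvPolynomial ℕ ℚ
  | 0 => 1
  | n + 1 => (1 / ((n : ℚ) + 1)) •
      ∑ k : Fin (n / 2 + 1), X (k : ℕ) * completeNat (n - 2 * (k : ℕ))
termination_by n => n
decreasing_by omega

/-- The complete symmetric function `h_n`, written in the odd power sums `p_k = X k` of degree
`2k+1` (with the even power sums set to zero), and extended by zero to negative indices. -/
noncomputable def complete (n : ℤ) : MvPolynomial ℕ ℚ := if 0 ≤ n then completeNat n.toNat else 0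

theorem complete_of_neg {n : ℤ} (hn : n < 0) : complete n = 0 := if_neg (by lia)

theorem complete_zero : complete 0 = 1 := by simp [complete, completeNat]

theorem complete_succ (n : ℕ) : complete (n + 1 : ℕ) = (1 / ((n : ℚ) + 1)) •
    ∑ k ∈ Finset.range (n / 2 + 1), X k * complete ((n + 1 : ℕ) - 2 * k - 1) := by
  have hterm : ∀ k ∈ Finset.range (n / 2 + 1),
      X k * complete ((n + 1 : ℕ) - 2 * k - 1) = X k * completeNat (n - 2 * k) := fun k hk => by
    have := Finset.mem_range.1 hk
    rw [complete, if_pos (by lia)]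
    congr 2
    lia
  rw [Finset.sum_congr rfl hterm, complete, if_pos (by lia), Int.toNat_natCast, completeNat,
    Finset.sum_range]

theorem smul_complete {n : ℤ} {M : ℕ} (hM : n ≤ 2 * M) :
    (n : ℚ) • complete n = ∑ k ∈ Finset.range M, X k * complete (n - 2 * k - 1) := by
  rcases le_or_gt n 0 with hn | hn
  · rw [Finset.sum_eq_zero fun k _ => by rw [complete_of_neg (by lia), mul_zero]]
    rcases hn.lt_or_eq with hn | rfl
    · rw [complete_of_neg hn, smul_zero]
    · rw [Int.cast_zero, zero_smul]
  · obtain ⟨m, rfl⟩ : ∃ m : ℕ, n = (m + 1 : ℕ) := ⟨n.toNat - 1, by lia⟩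
    have hm : (((m + 1 : ℕ) : ℤ) : ℚ) * (1 / ((m : ℚ) + 1)) = 1 := by
      push_cast
      field_simp
    rw [complete_succ, smul_smul, hm, one_smul]
    refine Finset.sum_subset (Finset.range_subset_range.2 (by lia)) fun k _ hk => ?_
    have := mt Finset.mem_range.2 hk
    rw [complete_of_neg (by lia), mul_zero]

theorem sum_X_mul_sum_mul_complete (f : ℕ → MvPolynomial ℕ ℚ) {n : ℤ} {M : ℕ} (hM : n ≤ 2 * M) :
    ∑ k ∈ Finset.range M, X k * ∑ l ∈ Finset.range M, f l * complete (n - 2 * k - 1 - 2 * l - 1) =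
      ∑ l ∈ Finset.range M, ((n : ℚ) - 2 * l - 1) • (f l * complete (n - 2 * l - 1)) := by
  simp only [Finset.mul_sum]
  rw [Finset.sum_comm]
  refine Finset.sum_congr rfl fun l _ => ?_
  have h : ((n : ℚ) - 2 * l - 1) • complete (n - 2 * l - 1) =
      ∑ k ∈ Finset.range M, X k * complete (n - 2 * k - 1 - 2 * l - 1) := by
    simpa [sub_right_comm] using smul_complete (n := n - 2 * l - 1) (M := M) (by lia)
  rw [← mul_smul_comm, h, Finset.mul_sum]
  exact Finset.sum_congr rfl fun k _ => by ring

/-- The derivation `p_k ↦ (2k+1) p_{k+d}`. -/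
noncomputable def raise (d : ℕ) : Derivation ℚ (MvPolynomial ℕ ℚ) (MvPolynomial ℕ ℚ) :=
  mkDerivation ℚ fun k => (2 * (k : ℚ) + 1) • X (k + d)

theorem raise_X (d k : ℕ) : raise d (X k) = (2 * (k : ℚ) + 1) • X (k + d) := mkDerivation_X _ _ _

theorem raise_complete (d : ℕ) {n : ℤ} {M : ℕ} (hM : n ≤ 2 * M) :
    raise d (complete n) = ∑ k ∈ Finset.range M, X (k + d) * complete (n - 2 * k - 1) := by
  induction hN : n.toNat using Nat.strong_induction_on generalizing n with | _ N ih
  rcases le_or_gt n 0 with hn | hn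
  · rw [Finset.sum_eq_zero fun k _ => by rw [complete_of_neg (by lia), mul_zero]]
    rcases hn.lt_or_eq with hn | rfl
    · rw [complete_of_neg hn, map_zero]
    · rw [complete_zero, Derivation.map_one_eq_zero]
  have hterm : ∀ k : ℕ, raise d (X k * complete (n - 2 * k - 1)) =
      X k * ∑ l ∈ Finset.range M, X (l + d) * complete (n - 2 * k - 1 - 2 * l - 1)
        + (2 * (k : ℚ) + 1) • (X (k + d) * complete (n - 2 * k - 1)) := fun k => by
    rw [Derivation.leibniz, raise_X, ih _ (by lia) (by lia) rfl, smul_eq_mul, smul_eq_mul,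
      mul_smul_comm, mul_comm (complete _)]
  have hn0 : (n : ℚ) ≠ 0 := by exact_mod_cast hn.ne'
  refine smul_right_injective _ hn0 ?_
  beta_reduce
  rw [← Derivation.map_smul, smul_complete hM, map_sum, Finset.sum_congr rfl fun k _ => hterm k,
    Finset.sum_add_distrib, sum_X_mul_sum_mul_complete _ hM, ← Finset.sum_add_distrib,
    Finset.smul_sum]
  exact Finset.sum_congr rfl fun k _ => by module

theorem raise_zero_complete (n : ℤ) : raise 0 (complete n) = (n : ℚ) • complete n := by
  have hM : n ≤ 2 * n.toNat := by lia
  rw [raise_complete 0 hM, smul_complete hM]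
  rfl

theorem raise_complete_add_two (d : ℕ) (n : ℤ) :
    raise d (complete (n + 2)) = X d * complete (n + 1) + raise (d + 1) (complete n) := by
  have hM : n ≤ 2 * n.toNat := by lia
  rw [raise_complete (M := n.toNat + 1) d (by lia), raise_complete (d + 1) hM,
    Finset.sum_range_succ', add_comm]
  refine congrArg₂ _ (by congr 2 <;> grind) (Finset.sum_congr rfl fun k _ => ?_)
  congr 2 <;> grind

/-- The part of the Virasoro constraint on a functional that is a multiplication operator. -/
noncomputable def quadratic (d : ℕ) : MvPolynomial ℕ ℚ :=
  (1 / 2 : ℚ) • ∑ a ∈ Finset.range d, X a * X (d - 1 - a) + anomaly d • 1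

theorem sum_range_sum_range_add {M : ℕ} {f : ℕ → MvPolynomial ℕ ℚ} (hf : ∀ m, M ≤ m → f m = 0) :
    ∑ k ∈ Finset.range M, ∑ l ∈ Finset.range M, f (l + k) =
      ∑ m ∈ Finset.range M, ((m : ℚ) + 1) • f m := by
  have h : ∀ k ∈ Finset.range M,
      ∑ l ∈ Finset.range M, f (l + k) = ∑ m ∈ Finset.Ico k M, f m := fun k _ => by
    rw [Finset.sum_Ico_eq_sum_range]
    simp only [add_comm _ k]
    refine (Finset.sum_subset (Finset.range_subset_range.2 (by lia)) fun x _ hx => hf _ ?_).symm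
    have := mt Finset.mem_range.2 hx
    lia
  rw [Finset.sum_congr rfl h, Finset.sum_comm' (t' := Finset.range M)
    (s' := fun m => Finset.range (m + 1))
    (by intro x y; simp only [Finset.mem_range, Finset.mem_Ico]; lia)]
  refine Finset.sum_congr rfl fun m _ => ?_
  rw [Finset.sum_const, Finset.card_range]
  module

theorem sum_range_sum_range_sub {M : ℕ} {f : ℕ → ℕ → MvPolynomial ℕ ℚ}
    (hf : ∀ a b, M ≤ a + b + 1 → f a b = 0) :
    ∑ k ∈ Finset.range M, ∑ a ∈ Finset.range k, f a (k - 1 - a) =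
      ∑ a ∈ Finset.range M, ∑ b ∈ Finset.range M, f a b := by
  rw [Finset.sum_comm' (t' := Finset.range M) (s' := fun a => Finset.Ico (a + 1) M)
    (by intro x y; simp only [Finset.mem_range, Finset.mem_Ico]; lia)]
  refine Finset.sum_congr rfl fun a _ => ?_
  rw [Finset.sum_Ico_eq_sum_range]
  refine Finset.sum_subset_zero_on_sdiff (Finset.range_subset_range.2 (by lia)) (fun x hx => ?_)
    fun x _ => by congr 1; lia
  have := mt Finset.mem_range.2 (Finset.mem_sdiff.1 hx).2
  exact hf _ _ (by lia)

theorem sum_raise_complete {n : ℤ} {M : ℕ} (hM : n ≤ 2 * M) :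
    ∑ k ∈ Finset.range M, raise k (complete (n - 2 * k)) =
      ∑ m ∈ Finset.range M, ((m : ℚ) + 1) • (X m * complete (n - 2 * m - 1)) := by
  rw [← sum_range_sum_range_add (f := fun m => X m * complete (n - 2 * m - 1)) fun m hm => by
    rw [complete_of_neg (by lia), mul_zero]]
  refine Finset.sum_congr rfl fun k _ => ?_
  rw [raise_complete (M := M) k (by lia)]
  refine Finset.sum_congr rfl fun l _ => ?_
  congr 2
  grind

theorem sum_anomaly_smul_complete {n : ℤ} {M : ℕ} (hM : n < 2 * M) :
    ∑ k ∈ Finset.range M, anomaly k • complete (n - 2 * k) = (1 / 8 : ℚ) • complete n := by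
  rcases M.eq_zero_or_pos with rfl | hM0
  · rw [complete_of_neg (by lia), Finset.sum_range_zero, smul_zero]
  · simp [anomaly, hM0]

theorem sum_quadratic_mul_complete {n : ℤ} {M : ℕ} (hM : n < 2 * M) :
    ∑ k ∈ Finset.range M, quadratic k * complete (n - 2 * k) =
      (1 / 2 : ℚ) • ∑ m ∈ Finset.range M, ((n : ℚ) - 2 * m - 1) • (X m * complete (n - 2 * m - 1))
        + (1 / 8 : ℚ) • complete n := by
  have hterm : ∀ k : ℕ, ∀ a ∈ Finset.range k, X a * X (k - 1 - a) * complete (n - 2 * k) =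
      X a * (X (k - 1 - a) * complete (n - 2 * a - 1 - 2 * (k - 1 - a : ℕ) - 1)) := fun k a ha => by
    have := Finset.mem_range.1 ha
    rw [mul_assoc]
    congr 3
    lia
  simp only [quadratic, add_mul, smul_mul_assoc, one_mul, Finset.sum_add_distrib, Finset.sum_mul,
    sum_anomaly_smul_complete hM]
  rw [← Finset.smul_sum, Finset.sum_congr rfl fun k _ => Finset.sum_congr rfl (hterm k),
    sum_range_sum_range_sub
      (f := fun a b => X a * (X b * complete (n - 2 * a - 1 - 2 * b - 1))) fun a b h => by
        rw [complete_of_neg (by lia), mul_zero, mul_zero]]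
  simp only [← Finset.mul_sum]
  rw [sum_X_mul_sum_mul_complete X hM.le]

theorem sum_raise_complete_add_quadratic_mul_complete {n : ℤ} {M : ℕ} (hM : n < 2 * M) :
    ∑ k ∈ Finset.range M, (raise k (complete (n - 2 * k)) + quadratic k * complete (n - 2 * k)) =
      (((n : ℚ) + 1 / 2) ^ 2 / 2) • complete n := by
  rw [Finset.sum_add_distrib, sum_raise_complete hM.le, sum_quadratic_mul_complete hM, ← add_assoc,
    Finset.smul_sum, ← Finset.sum_add_distrib]
  have hterm : ∀ m : ℕ, ((m : ℚ) + 1) • (X m * complete (n - 2 * m - 1))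
      + (1 / 2 : ℚ) • ((n : ℚ) - 2 * m - 1) • (X m * complete (n - 2 * m - 1)) =
      (((n : ℚ) + 1) / 2) • (X m * complete (n - 2 * m - 1)) := fun m => by module
  simp only [hterm]
  rw [← Finset.smul_sum, ← smul_complete hM.le]
  module

/-- The Virasoro constraints for a normalized linear functional on polynomials in the odd power
sums, i.e. for the functional `∏ p_{dᵢ} ↦ Z(d₁,…,dₙ)` given by the coefficients of a partition
function `Z`. -/
structure IsVirasoroFunctional (φ : MvPolynomial ℕ ℚ →ₗ[ℚ] ℚ) : Prop where
  map_one : φ 1 = 1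
  map_X_mul : ∀ d f, φ (X d * f) = φ (raise d f + quadratic d * f)

/-- The value of a functional on the product `h_i h_j` of complete symmetric functions. -/
noncomputable def pairing (φ : MvPolynomial ℕ ℚ →ₗ[ℚ] ℚ) (i j : ℤ) : ℚ :=
  φ (complete i * complete j)

theorem pairing_comm (φ : MvPolynomial ℕ ℚ →ₗ[ℚ] ℚ) (i j : ℤ) : pairing φ i j = pairing φ j i := by
  rw [pairing, pairing, mul_comm]

theorem pairing_of_neg (φ : MvPolynomial ℕ ℚ →ₗ[ℚ] ℚ) {i : ℤ} (hi : i < 0) (j : ℤ) :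
    pairing φ i j = 0 := by
  rw [pairing, complete_of_neg hi, zero_mul, map_zero]

theorem mul_pairing_eq_sum (φ : MvPolynomial ℕ ℚ →ₗ[ℚ] ℚ) {i : ℤ} (j : ℤ) {M : ℕ}
    (hM : i ≤ 2 * M) :
    i * pairing φ i j =
      ∑ k ∈ Finset.range M, φ (X k * (complete (i - 2 * k - 1) * complete j)) := by
  rw [pairing, ← smul_eq_mul, ← map_smul, ← smul_mul_assoc, smul_complete hM, Finset.sum_mul,
    map_sum]
  simp only [mul_assoc]

namespace IsVirasoroFunctional

variable {φ : MvPolynomial ℕ ℚ →ₗ[ℚ] ℚ}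

theorem mul_pairing (hφ : IsVirasoroFunctional φ) {i : ℤ} (j : ℤ) {M : ℕ} (hM : i ≤ 2 * M) :
    i * pairing φ i j = ((i : ℚ) - 1 / 2) ^ 2 / 2 * pairing φ (i - 1) j
      + ∑ k ∈ Finset.range M, φ (complete (i - 2 * k - 1) * raise k (complete j)) := by
  have hsum := sum_raise_complete_add_quadratic_mul_complete (n := i - 1) (M := M) (by lia)
  simp only [sub_right_comm i 1] at hsum
  have hcoeff : ((i : ℚ) - 1 / 2) ^ 2 / 2 = (((i - 1 : ℤ) : ℚ) + 1 / 2) ^ 2 / 2 := by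
    push_cast
    ring
  rw [mul_pairing_eq_sum φ j hM, pairing, hcoeff, ← smul_eq_mul, ← map_smul, ← smul_mul_assoc,
    ← hsum, Finset.sum_mul, map_sum, ← Finset.sum_add_distrib]
  refine Finset.sum_congr rfl fun k _ => ?_
  rw [hφ.map_X_mul, ← map_add, Derivation.leibniz, smul_eq_mul, smul_eq_mul]
  congr 1
  ring

theorem mul_pairing_zero (hφ : IsVirasoroFunctional φ) (i : ℤ) :
    i * pairing φ i 0 = ((i : ℚ) - 1 / 2) ^ 2 / 2 * pairing φ (i - 1) 0 := by
  rw [hφ.mul_pairing 0 (M := i.toNat) (by lia), complete_zero]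
  simp

/-- Subtracting the constraints for `h_i h_{j+2}` from those for `h_{i+2} h_j` leaves only values of
`φ` on products of two complete symmetric functions. -/
theorem pairing_rec (hφ : IsVirasoroFunctional φ) (i j : ℤ) :
    ((i : ℚ) + 2) * pairing φ (i + 2) j - ((i : ℚ) + 3 / 2) ^ 2 / 2 * pairing φ (i + 1) j
      - (i * pairing φ i (j + 2) - ((i : ℚ) - 1 / 2) ^ 2 / 2 * pairing φ (i - 1) (j + 2))
      = j * pairing φ (i + 1) j - i * pairing φ i (j + 1) := by
  have hM : i ≤ 2 * i.toNat := by lia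
  have hfirst := hφ.mul_pairing (i := i + 2) j (M := i.toNat + 1) (by lia)
  have hsecond := hφ.mul_pairing (j + 2) hM
  have hzero : φ (complete (i + 1) * raise 0 (complete j)) = j * pairing φ (i + 1) j := by
    rw [raise_zero_complete, mul_smul_comm, map_smul, pairing, smul_eq_mul]
  have hsum : ∑ k ∈ Finset.range i.toNat, φ (complete (i - 2 * k - 1) * (X k * complete (j + 1))) =
      i * pairing φ i (j + 1) := by
    rw [mul_pairing_eq_sum φ (j + 1) hM]
    simp only [mul_left_comm]
  have hindex : ∀ k : ℕ, i + 2 - 2 * ((k + 1 : ℕ) : ℤ) - 1 = i - 2 * k - 1 := by lia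
  rw [Finset.sum_range_succ', show i + 2 - 2 * ((0 : ℕ) : ℤ) - 1 = i + 1 by lia, hzero,
    show i + 2 - 1 = i + 1 by lia] at hfirst
  simp only [hindex] at hfirst
  simp only [raise_complete_add_two, mul_add, map_add, Finset.sum_add_distrib, hsum] at hsecond
  push_cast at hfirst
  linear_combination hfirst - hsecond

end IsVirasoroFunctional

end OddPowerSum

/-! ### Reduction to products of Bessel coefficients -/

namespace OddPowerSum

/-- The coefficients `((2n-1)‼)² / (8ⁿ n!)` of the asymptotic expansion of the Bessel functions of
order zero. -/
def bessel : ℕ → ℚ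
  | 0 => 1
  | n + 1 => (2 * (n : ℚ) + 1) ^ 2 / (8 * ((n : ℚ) + 1)) * bessel n

theorem bessel_succ (n : ℕ) :
    bessel (n + 1) = (2 * (n : ℚ) + 1) ^ 2 / (8 * ((n : ℚ) + 1)) * bessel n := rfl

/-- The common value of `b_{i+1} b_j - b_i b_{j+1} - (i - j) b_i b_j`, for the Bessel coefficients
`b`, and of the difference of the pairings `(i+1, j)` and `(i, j+1)`. -/
def besselDiff (i j : ℕ) : ℚ :=
  bessel i * bessel j * ((j : ℚ) - i) * (4 * (i + 1) * (j + 1) + 1) / (8 * (i + 1) * (j + 1))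

theorem besselDiff_eq (i j : ℕ) : besselDiff i j =
    bessel (i + 1) * bessel j - bessel i * bessel (j + 1)
      - ((i : ℚ) - j) * (bessel i * bessel j) := by
  rw [besselDiff, bessel_succ, bessel_succ]
  field_simp
  ring

theorem besselDiff_add_two (i j : ℕ) : ((i : ℚ) + 3) * besselDiff (i + 2) j =
    -((i : ℚ) + 3) * besselDiff (i + 1) (j + 1)
      - bessel i * bessel (j + 2) * ((j : ℚ) + 2 + 1 / (4 * ((i : ℚ) + 1)))
      + (((i : ℚ) + 5 / 2) ^ 2 / 2 + j) * (besselDiff i (j + 1) + besselDiff (i + 1) j)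
      - ((i : ℚ) + 1) * besselDiff i (j + 1) := by
  simp only [besselDiff, bessel_succ]
  push_cast
  field_simp
  ring

theorem besselDiff_succ (i j : ℕ) :
    bessel (i + 1) * bessel j * ((j : ℚ) + 1 / (4 * ((i : ℚ) + 1 + 1))) =
      bessel i * bessel (j + 1) * ((j : ℚ) + 1 + 1 / (4 * ((i : ℚ) + 1)))
        + 2 * besselDiff (i + 1) j - ((i : ℚ) + 1 + j) * besselDiff i j := by
  simp only [besselDiff, bessel_succ]
  push_cast
  field_simp
  ring

namespace IsVirasoroFunctional

variable {φ : MvPolynomial ℕ ℚ →ₗ[ℚ] ℚ}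

theorem pairing_zero_right (hφ : IsVirasoroFunctional φ) (n : ℕ) : pairing φ n 0 = bessel n := by
  induction n with
  | zero => simp [pairing, complete_zero, hφ.map_one, bessel]
  | succ n ih =>
    have h := hφ.mul_pairing_zero (n + 1 : ℕ)
    rw [show ((n + 1 : ℕ) : ℤ) - 1 = n by lia, ih] at h
    rw [bessel_succ]
    push_cast at h ⊢
    field_simp
    linear_combination 8 * h

theorem pairing_zero_left (hφ : IsVirasoroFunctional φ) (n : ℕ) : pairing φ 0 n = bessel n := by
  rw [pairing_comm, hφ.pairing_zero_right]

theorem pairing_one_left (hφ : IsVirasoroFunctional φ) (j : ℕ) :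
    pairing φ 1 j = ((j : ℚ) + 1 / 8) * bessel j := by
  have h := hφ.pairing_rec (-1) j
  simp only [pairing_of_neg φ (i := -1) (by lia), pairing_of_neg φ (i := -1 - 1) (by lia),
    show (-1 : ℤ) + 2 = 1 by lia, show (-1 : ℤ) + 1 = 0 by lia, hφ.pairing_zero_left] at h
  push_cast at h
  linear_combination h

theorem two_mul_pairing_two_left (hφ : IsVirasoroFunctional φ) (j : ℕ) :
    2 * pairing φ 2 j = ((j : ℚ) + 9 / 8) * pairing φ 1 j := by
  have h := hφ.pairing_rec 0 j
  simp only [pairing_of_neg φ (i := 0 - 1) (by lia), zero_add] at h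
  push_cast at h
  linear_combination h

theorem pairing_add_three (hφ : IsVirasoroFunctional φ) (i j : ℕ) :
    ((i : ℚ) + 3) * pairing φ (i + 3 : ℕ) j =
      (((i : ℚ) + 5 / 2) ^ 2 / 2 + j) * pairing φ (i + 2 : ℕ) j
        + (i + 1) * pairing φ (i + 1 : ℕ) (j + 2 : ℕ)
        - ((i : ℚ) + 1 / 2) ^ 2 / 2 * pairing φ i (j + 2 : ℕ)
        - (i + 1) * pairing φ (i + 1 : ℕ) (j + 1 : ℕ) := by
  have h := hφ.pairing_rec (i + 1 : ℕ) j
  push_cast at h ⊢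
  simp only [add_sub_cancel_right, add_assoc] at h
  norm_num at h
  linear_combination h

/-- The induction for the difference needs two consecutive instances of it, together with the
instance of an additional linear relation. -/
theorem pairing_succ_sub_and_two_mul_pairing_succ_sub (hφ : IsVirasoroFunctional φ) (i : ℕ) :
    (∀ j : ℕ, pairing φ (i + 1 : ℕ) j - pairing φ i (j + 1 : ℕ) = besselDiff i j) ∧
    (∀ j : ℕ, pairing φ (i + 2 : ℕ) j - pairing φ (i + 1 : ℕ) (j + 1 : ℕ) =
      besselDiff (i + 1) j) ∧
    ∀ j : ℕ, 2 * pairing φ (i + 1 : ℕ) j - ((i : ℚ) + j) * pairing φ i j =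
      bessel i * bessel j * (j + 1 / (4 * ((i : ℚ) + 1))) := by
  induction i with
  | zero =>
    refine ⟨fun j => ?_, fun j => ?_, fun j => ?_⟩
    · simp only [zero_add, Nat.cast_one, Nat.cast_zero, hφ.pairing_one_left, hφ.pairing_zero_left,
        besselDiff, bessel]
      field_simp
      ring
    · have h := hφ.two_mul_pairing_two_left j
      simp only [zero_add, Nat.cast_one, Nat.cast_ofNat, hφ.pairing_one_left, besselDiff,
        bessel] at h ⊢
      push_cast
      field_simp
      linear_combination 64 * ((j : ℚ) + 1) * h
    · simp only [zero_add, Nat.cast_one, Nat.cast_zero, hφ.pairing_one_left, hφ.pairing_zero_left,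
        bessel]
      ring
  | succ i ih =>
    obtain ⟨hdiff, hdiff', hlin⟩ := ih
    refine ⟨hdiff', fun j => ?_, fun j => ?_⟩
    · have hrec := hφ.pairing_add_three i j
      have hlin := hlin (j + 2)
      refine mul_left_cancel₀ (by positivity : (i : ℚ) + 3 ≠ 0) ?_
      simp only [Nat.cast_add (R := ℚ), Nat.cast_ofNat (R := ℚ)] at hlin
      linear_combination hrec - besselDiff_add_two i j - ((i : ℚ) + 3) * hdiff' (j + 1)
        + (((i : ℚ) + 5 / 2) ^ 2 / 2 + j) * (hdiff (j + 1) + hdiff' j)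
        - ((i : ℚ) + 1) * hdiff (j + 1) - hlin
    · have hlin := hlin (j + 1)
      simp only [Nat.cast_add (R := ℚ), Nat.cast_one (R := ℚ)] at hlin ⊢
      linear_combination hlin + 2 * hdiff' j - ((i : ℚ) + 1 + j) * hdiff j - besselDiff_succ i j

theorem pairing_succ_sub (hφ : IsVirasoroFunctional φ) (i j : ℕ) :
    pairing φ (i + 1 : ℕ) j - pairing φ i (j + 1 : ℕ) =
      bessel (i + 1) * bessel j - bessel i * bessel (j + 1)
        - ((i : ℚ) - j) * (bessel i * bessel j) := by
  rw [(hφ.pairing_succ_sub_and_two_mul_pairing_succ_sub i).1 j, besselDiff_eq]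

end IsVirasoroFunctional

end OddPowerSum

/-! ### One-point values -/

section EulerOperator

open PowerSeries

variable {R : Type*} [CommRing R]

/-- The Euler operator `x d/dx` on power series. -/
noncomputable def eulerOperator (R : Type*) [CommRing R] : Derivation R R⟦X⟧ R⟦X⟧ :=
  (X : R⟦X⟧) • d⁄dX R

theorem coeff_eulerOperator (f : R⟦X⟧) (n : ℕ) :
    coeff n (eulerOperator R f) = n * coeff n f := by
  rw [eulerOperator, Derivation.smul_apply, smul_eq_mul]
  cases n with
  | zero => simp
  | succ n => rw [coeff_succ_X_mul, coeff_derivative, mul_comm, Nat.cast_succ]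

theorem eulerOperator_mul (f g : R⟦X⟧) :
    eulerOperator R (f * g) = eulerOperator R f * g + f * eulerOperator R g := by
  rw [Derivation.leibniz, smul_eq_mul, smul_eq_mul, mul_comm g, add_comm]

theorem coeff_evalNegHom (f : R⟦X⟧) (n : ℕ) : coeff n (evalNegHom f) = (-1) ^ n * coeff n f :=
  coeff_rescale f (-1) n

theorem eulerOperator_evalNegHom (f : R⟦X⟧) :
    eulerOperator R (evalNegHom f) = evalNegHom (eulerOperator R f) := by
  ext n
  simp only [coeff_eulerOperator, coeff_evalNegHom]
  ring

end EulerOperator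

namespace OddPowerSum

open PowerSeries
open Finset.HasAntidiagonal (antidiagonal)

/-- The generating series `∑ h_n x^n` of the complete symmetric functions. -/
noncomputable def completeSeries : (MvPolynomial ℕ ℚ)⟦X⟧ := mk fun n => complete n

/-- The generating series `∑ p_k x^(2k+1)` of the odd power sums. -/
noncomputable def powerSumSeries : (MvPolynomial ℕ ℚ)⟦X⟧ :=
  mk fun n => if Odd n then MvPolynomial.X (n / 2) else 0

theorem sum_range_two_mul_ite_odd {R : Type*} [Semiring R] (f h : ℕ → R) (M : ℕ) :
    ∑ i ∈ Finset.range (2 * M), (if Odd i then f (i / 2) else 0) * h i =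
      ∑ k ∈ Finset.range M, f k * h (2 * k + 1) := by
  induction M with
  | zero => simp
  | succ M ih =>
    rw [mul_add_one, Finset.sum_range_succ, Finset.sum_range_succ, ih, Finset.sum_range_succ,
      if_neg (by simp), if_pos ⟨M, rfl⟩, zero_mul, add_zero, show (2 * M + 1) / 2 = M by lia]

theorem eulerOperator_completeSeries :
    eulerOperator _ completeSeries = powerSumSeries * completeSeries := by
  ext1 n
  have hsub : Finset.range (n + 1) ⊆ Finset.range (2 * (n + 1)) :=
    Finset.range_subset_range.2 (by lia)
  calc coeff n (eulerOperator _ completeSeries)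
      = ((n : ℤ) : ℚ) • complete n := by
        rw [coeff_eulerOperator, completeSeries, coeff_mk, Algebra.smul_def, Int.cast_natCast,
          map_natCast]
    _ = ∑ k ∈ Finset.range (n + 1), MvPolynomial.X k * complete (n - 2 * k - 1) :=
        smul_complete (by lia)
    _ = ∑ i ∈ Finset.range (2 * (n + 1)),
          (if Odd i then MvPolynomial.X (i / 2) else 0) * complete (n - i) := by
        rw [sum_range_two_mul_ite_odd MvPolynomial.X (fun i => complete (n - i))]
        exact Finset.sum_congr rfl fun k _ => by congr 2; lia
    _ = ∑ i ∈ Finset.range (n + 1),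
          (if Odd i then MvPolynomial.X (i / 2) else 0) * complete (n - i : ℕ) := by
        rw [← Finset.sum_subset hsub fun i _ hi => by
          rw [complete_of_neg (by have := mt Finset.mem_range.2 hi; lia), mul_zero]]
        exact Finset.sum_congr rfl fun i hi => by
          rw [Nat.cast_sub (Finset.mem_range_succ_iff.1 hi)]
    _ = coeff n (powerSumSeries * completeSeries) := by
        simp only [coeff_mul, powerSumSeries, completeSeries, coeff_mk]
        rw [Finset.Nat.sum_antidiagonal_eq_sum_range_succ
          (fun i j => (if Odd i then MvPolynomial.X (i / 2) else 0) * complete j)]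

theorem evalNegHom_powerSumSeries : evalNegHom powerSumSeries = -powerSumSeries := by
  ext1 n
  rw [coeff_evalNegHom, map_neg, powerSumSeries, coeff_mk]
  split_ifs with h
  · rw [h.neg_one_pow, neg_one_mul]
  · rw [mul_zero, neg_zero]

theorem completeSeries_mul_evalNegHom : completeSeries * evalNegHom completeSeries = 1 := by
  have h : eulerOperator _ (completeSeries * evalNegHom completeSeries) = 0 := by
    rw [eulerOperator_mul, eulerOperator_evalNegHom, eulerOperator_completeSeries, map_mul,
      evalNegHom_powerSumSeries]
    ring
  ext1 n
  rcases n with _ | n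
  · simp [coeff_mul, coeff_evalNegHom, completeSeries, complete_zero]
  · have hn := congrArg (coeff (n + 1)) h
    rw [coeff_eulerOperator, map_zero, mul_eq_zero] at hn
    rw [hn.resolve_left (Nat.cast_ne_zero.2 n.succ_ne_zero), coeff_one, if_neg n.succ_ne_zero]

theorem X_eq_sum_complete_mul_complete (k : ℕ) : (MvPolynomial.X k : MvPolynomial ℕ ℚ) =
    ∑ p ∈ antidiagonal (2 * k + 1),
      ((-1 : ℚ) ^ p.2 * p.1) • (complete p.1 * complete p.2) := by
  have h : powerSumSeries = eulerOperator _ completeSeries * evalNegHom completeSeries := by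
    rw [eulerOperator_completeSeries, mul_assoc, completeSeries_mul_evalNegHom, mul_one]
  have hk := congrArg (coeff (2 * k + 1)) h
  rw [coeff_mul, powerSumSeries, coeff_mk, if_pos ⟨k, rfl⟩, show (2 * k + 1) / 2 = k by lia] at hk
  rw [hk]
  refine Finset.sum_congr rfl fun p _ => ?_
  rw [coeff_eulerOperator, coeff_evalNegHom, completeSeries, coeff_mk, coeff_mk]
  simp only [Algebra.smul_def, map_mul, map_pow, map_neg, map_one, map_natCast]
  ring

theorem map_X_eq_sum_pairing (φ : MvPolynomial ℕ ℚ →ₗ[ℚ] ℚ) (k : ℕ) :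
    φ (MvPolynomial.X k) =
      ∑ p ∈ antidiagonal (2 * k + 1), (-1 : ℚ) ^ p.2 * p.1 * pairing φ p.1 p.2 := by
  rw [X_eq_sum_complete_mul_complete, map_sum]
  exact Finset.sum_congr rfl fun p _ => map_smul _ _ _

/-- Summation by parts along an antidiagonal, with weights chosen so that the boundary terms depend
on the values of `F` on the axes only. -/
theorem sum_antidiagonal_mul_sub (F : ℕ → ℕ → ℚ) (k : ℕ) :
    ∑ p ∈ antidiagonal (2 * k),
        (-1 : ℚ) ^ p.2 * (p.1 + 1 / 2) * (F (p.1 + 1) p.2 - F p.1 (p.2 + 1)) =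
      2 * ∑ p ∈ antidiagonal (2 * k + 1), (-1 : ℚ) ^ p.2 * p.1 * F p.1 p.2
        - 1 / 2 * F 0 (2 * k + 1) - (2 * k + 3 / 2) * F (2 * k + 1) 0 := by
  have hleft := Finset.Nat.sum_antidiagonal_succ (n := 2 * k)
    (f := fun p => (-1 : ℚ) ^ p.2 * (p.1 - 1 / 2) * F p.1 p.2)
  have hright := Finset.Nat.sum_antidiagonal_succ' (n := 2 * k)
    (f := fun p => (-1 : ℚ) ^ p.2 * (p.1 + 1 / 2) * F p.1 p.2)
  have hsum : 2 * ∑ p ∈ antidiagonal (2 * k + 1), (-1 : ℚ) ^ p.2 * p.1 * F p.1 p.2 =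
      ∑ p ∈ antidiagonal (2 * k + 1), (-1 : ℚ) ^ p.2 * (p.1 - 1 / 2) * F p.1 p.2
      + ∑ p ∈ antidiagonal (2 * k + 1), (-1 : ℚ) ^ p.2 * (p.1 + 1 / 2) * F p.1 p.2 := by
    rw [← Finset.sum_add_distrib, Finset.mul_sum]
    exact Finset.sum_congr rfl fun p _ => by ring
  have hdiff : ∑ p ∈ antidiagonal (2 * k),
        (-1 : ℚ) ^ p.2 * (p.1 + 1 / 2) * (F (p.1 + 1) p.2 - F p.1 (p.2 + 1)) =
      ∑ p ∈ antidiagonal (2 * k),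
        (-1 : ℚ) ^ p.2 * ((p.1 + 1 : ℕ) - 1 / 2) * F (p.1 + 1) p.2
      + ∑ p ∈ antidiagonal (2 * k),
        (-1 : ℚ) ^ (p.2 + 1) * (p.1 + 1 / 2) * F p.1 (p.2 + 1) := by
    rw [← Finset.sum_add_distrib]
    exact Finset.sum_congr rfl fun p _ => by push_cast; ring
  have hodd : (-1 : ℚ) ^ (2 * k + 1) = -1 := Odd.neg_one_pow ⟨k, rfl⟩
  simp only [hodd] at hleft
  push_cast at hleft hright hdiff
  linear_combination hdiff - hleft - hright - hsum

theorem IsVirasoroFunctional.two_mul_map_X {φ : MvPolynomial ℕ ℚ →ₗ[ℚ] ℚ}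
    (hφ : IsVirasoroFunctional φ) (k : ℕ) : 2 * φ (MvPolynomial.X k) =
      2 * ∑ p ∈ antidiagonal (2 * k + 1), (-1 : ℚ) ^ p.2 * p.1 * (bessel p.1 * bessel p.2)
      - ∑ p ∈ antidiagonal (2 * k),
          (-1 : ℚ) ^ p.2 * (p.1 + 1 / 2) * (((p.1 : ℚ) - p.2) * (bessel p.1 * bessel p.2)) := by
  have hpairing := sum_antidiagonal_mul_sub (fun i j => pairing φ i j) k
  have hbessel := sum_antidiagonal_mul_sub (fun i j => bessel i * bessel j) k
  simp only [hφ.pairing_succ_sub, mul_sub _ (_ - _) (_ * _), Finset.sum_sub_distrib,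
    ← map_X_eq_sum_pairing, Nat.cast_zero, hφ.pairing_zero_left, hφ.pairing_zero_right]
    at hpairing
  simp only [show bessel 0 = 1 from rfl, one_mul, mul_one] at hbessel
  linear_combination hbessel - hpairing

/-- The generating series `y(x)` of the Bessel coefficients. -/
noncomputable def besselSeries : ℚ⟦X⟧ := mk bessel

theorem eulerOperator_besselSeries : (8 : ℚ) • eulerOperator ℚ besselSeries =
    X * ((4 : ℚ) • eulerOperator ℚ (eulerOperator ℚ besselSeries)
      + (4 : ℚ) • eulerOperator ℚ besselSeries + besselSeries) := by
  ext n
  rcases n with _ | n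
  · simp [coeff_eulerOperator]
  · simp only [map_add, map_smul, smul_eq_mul, coeff_succ_X_mul, coeff_eulerOperator, besselSeries,
      coeff_mk, bessel_succ]
    push_cast
    field_simp
    ring

theorem eulerOperator_evalNegHom_besselSeries :
    (8 : ℚ) • eulerOperator ℚ (evalNegHom besselSeries) =
      -(X * ((4 : ℚ) • eulerOperator ℚ (eulerOperator ℚ (evalNegHom besselSeries))
        + (4 : ℚ) • eulerOperator ℚ (evalNegHom besselSeries) + evalNegHom besselSeries)) := by
  have h := congrArg evalNegHom eulerOperator_besselSeries
  simp only [map_mul, map_add, map_rat_smul, evalNegHom_X, ← eulerOperator_evalNegHom] at h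
  rw [h, neg_mul]

/-- The product `y(x) y(-x)` of the Bessel series. -/
noncomputable def besselProduct : ℚ⟦X⟧ := besselSeries * evalNegHom besselSeries

/-- The Wronskian of `y(x)` and `y(-x)` for the Euler operator. -/
noncomputable def besselWronskian : ℚ⟦X⟧ :=
  eulerOperator ℚ besselSeries * evalNegHom besselSeries
    - besselSeries * eulerOperator ℚ (evalNegHom besselSeries)

/-- The product of the derivatives of `y(x)` and `y(-x)` for the Euler operator. -/
noncomputable def besselDerivProduct : ℚ⟦X⟧ :=
  eulerOperator ℚ besselSeries * eulerOperator ℚ (evalNegHom besselSeries)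

theorem coeff_besselWronskian (n : ℕ) :
    coeff n besselWronskian = 2 * coeff (n + 1) besselProduct := by
  have hode : X * ((4 : ℚ) • eulerOperator ℚ besselWronskian + (4 : ℚ) • besselWronskian) =
      (8 : ℚ) • eulerOperator ℚ besselProduct := by
    simp only [besselWronskian, besselProduct, map_sub, eulerOperator_mul]
    linear_combination (norm := algebra)
      -(evalNegHom besselSeries) * eulerOperator_besselSeries
        - besselSeries * eulerOperator_evalNegHom_besselSeries
  have hcoeff := congrArg (coeff (n + 1)) hode
  simp only [coeff_succ_X_mul, map_add, map_smul, smul_eq_mul, coeff_eulerOperator] at hcoeff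
  refine mul_left_cancel₀ (by positivity : (n : ℚ) + 1 ≠ 0) ?_
  push_cast at hcoeff
  linear_combination hcoeff / 4

theorem coeff_besselDerivProduct (n : ℕ) :
    4 * ((n : ℚ) + 2) * coeff n besselDerivProduct = -n * coeff n besselProduct := by
  have hode : X * ((4 : ℚ) • eulerOperator ℚ besselDerivProduct + (8 : ℚ) • besselDerivProduct
      + eulerOperator ℚ besselProduct) = 0 := by
    simp only [besselDerivProduct, besselProduct, eulerOperator_mul]
    linear_combination (norm := algebra)
      -(eulerOperator ℚ (evalNegHom besselSeries)) * eulerOperator_besselSeries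
        + eulerOperator ℚ besselSeries * eulerOperator_evalNegHom_besselSeries
  have hcoeff := congrArg (coeff (n + 1)) hode
  simp only [coeff_succ_X_mul, map_add, map_smul, smul_eq_mul, coeff_eulerOperator, map_zero]
    at hcoeff
  linear_combination hcoeff

theorem coeff_besselProduct_add_two (n : ℕ) :
    4 * ((n : ℚ) + 2) * coeff (n + 2) besselProduct =
      ((n : ℚ) + 1) ^ 3 * coeff n besselProduct := by
  have hode : X * ((4 : ℚ) • eulerOperator ℚ (eulerOperator ℚ besselProduct)
        + (4 : ℚ) • eulerOperator ℚ besselProduct + (2 : ℚ) • besselProduct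
        - (8 : ℚ) • besselDerivProduct) = (8 : ℚ) • besselWronskian := by
    simp only [besselWronskian, besselProduct, besselDerivProduct, map_add, eulerOperator_mul]
    linear_combination (norm := algebra)
      -(evalNegHom besselSeries) * eulerOperator_besselSeries
        + besselSeries * eulerOperator_evalNegHom_besselSeries
  have hcoeff := congrArg (coeff (n + 1)) hode
  simp only [coeff_succ_X_mul, map_add, map_sub, map_smul, smul_eq_mul, coeff_eulerOperator,
    coeff_besselWronskian] at hcoeff
  linear_combination -((n : ℚ) + 2) / 4 * hcoeff - coeff_besselDerivProduct n / 2

theorem coeff_besselProduct_odd (k : ℕ) : coeff (2 * k + 1) besselProduct = 0 := by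
  induction k with
  | zero =>
    have h := coeff_besselWronskian 0
    simp only [besselWronskian, map_sub, coeff_mul, Finset.HasAntidiagonal.antidiagonal_zero,
      Finset.sum_singleton, coeff_eulerOperator] at h
    linear_combination -h / 2
  | succ k ih =>
    have h := coeff_besselProduct_add_two (2 * k + 1)
    rw [ih, mul_zero] at h
    exact (mul_eq_zero.1 h).resolve_left (by positivity)

theorem sum_antidiagonal_mul_bessel_mul_bessel (k : ℕ) :
    ∑ p ∈ antidiagonal (2 * k + 1), (-1 : ℚ) ^ p.2 * p.1 * (bessel p.1 * bessel p.2) =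
      coeff (2 * k + 2) besselProduct := by
  have hleibniz : (2 : ℚ) • (eulerOperator ℚ besselSeries * evalNegHom besselSeries) =
      eulerOperator ℚ besselProduct + besselWronskian := by
    rw [besselProduct, besselWronskian, eulerOperator_mul]
    module
  have hcoeff := congrArg (coeff (2 * k + 1)) hleibniz
  rw [map_smul, map_add, coeff_eulerOperator, coeff_besselWronskian, coeff_besselProduct_odd,
    mul_zero, zero_add, smul_eq_mul, mul_right_inj' two_ne_zero] at hcoeff
  rw [← hcoeff, coeff_mul]
  refine Finset.sum_congr rfl fun p _ => ?_
  rw [coeff_eulerOperator, coeff_evalNegHom, besselSeries, coeff_mk, coeff_mk]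
  ring

theorem sum_antidiagonal_mul_sub_mul_bessel_mul_bessel (k : ℕ) :
    ∑ p ∈ antidiagonal (2 * k),
        (-1 : ℚ) ^ p.2 * (p.1 + 1 / 2) * (((p.1 : ℚ) - p.2) * (bessel p.1 * bessel p.2)) =
      2 * k ^ 2 * coeff (2 * k) besselProduct - 2 * coeff (2 * k) besselDerivProduct := by
  have hleibniz : (2 : ℚ) • (eulerOperator ℚ (eulerOperator ℚ besselSeries)
        * evalNegHom besselSeries - besselDerivProduct) =
      eulerOperator ℚ (eulerOperator ℚ besselProduct) + eulerOperator ℚ besselWronskian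
        - (4 : ℚ) • besselDerivProduct := by
    simp only [besselProduct, besselWronskian, besselDerivProduct, map_sub, map_add,
      eulerOperator_mul]
    module
  have hcoeff := congrArg (coeff (2 * k)) hleibniz
  have hsum : ∑ p ∈ antidiagonal (2 * k),
        (-1 : ℚ) ^ p.2 * (p.1 + 1 / 2) * (((p.1 : ℚ) - p.2) * (bessel p.1 * bessel p.2)) =
      coeff (2 * k) (eulerOperator ℚ (eulerOperator ℚ besselSeries) * evalNegHom besselSeries
        - besselDerivProduct) + 1 / 2 * coeff (2 * k) besselWronskian := by
    simp only [besselDerivProduct, besselWronskian, map_sub, coeff_mul, coeff_eulerOperator,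
      coeff_evalNegHom, besselSeries, coeff_mk, ← Finset.sum_sub_distrib, Finset.mul_sum,
      ← Finset.sum_add_distrib]
    exact Finset.sum_congr rfl fun p _ => by ring
  simp only [map_smul, map_add, map_sub, smul_eq_mul, coeff_eulerOperator] at hcoeff hsum
  rw [coeff_besselWronskian, coeff_besselProduct_odd] at hcoeff hsum
  push_cast at hcoeff
  linear_combination hsum + hcoeff / 2

theorem IsVirasoroFunctional.mul_map_X {φ : MvPolynomial ℕ ℚ →ₗ[ℚ] ℚ}
    (hφ : IsVirasoroFunctional φ) (k : ℕ) :
    (2 * (k : ℚ) + 1) * φ (MvPolynomial.X k) = coeff (2 * k + 2) besselProduct := by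
  have hmap := hφ.two_mul_map_X k
  have hderiv := coeff_besselDerivProduct (2 * k)
  have hrec := coeff_besselProduct_add_two (2 * k)
  rw [sum_antidiagonal_mul_bessel_mul_bessel, sum_antidiagonal_mul_sub_mul_bessel_mul_bessel]
    at hmap
  push_cast at hderiv hrec
  refine mul_left_cancel₀ (by positivity : 4 * ((k : ℚ) + 1) ≠ 0) ?_
  linear_combination 2 * ((k : ℚ) + 1) * (2 * k + 1) * hmap + (2 * (k : ℚ) + 1) / 2 * hderiv
    + k * hrec

theorem IsVirasoroFunctional.map_X_succ {φ : MvPolynomial ℕ ℚ →ₗ[ℚ] ℚ}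
    (hφ : IsVirasoroFunctional φ) (k : ℕ) :
    8 * ((k : ℚ) + 2) * φ (MvPolynomial.X (k + 1)) =
      (2 * (k : ℚ) + 3) ^ 2 * (2 * k + 1) * φ (MvPolynomial.X k) := by
  have h₀ := hφ.mul_map_X k
  have h₁ := hφ.mul_map_X (k + 1)
  have hrec := coeff_besselProduct_add_two (2 * k + 2)
  rw [mul_add_one 2 k] at h₁
  rw [← h₀, ← h₁] at hrec
  push_cast at hrec
  refine mul_left_cancel₀ (by positivity : 2 * (k : ℚ) + 3 ≠ 0) ?_
  linear_combination hrec

end OddPowerSum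

/-! ### The partition function as a Virasoro functional -/

namespace OddPowerSum

open MvPolynomial ShuffleAlgebra
open BGW (anomaly B partitionFunction permInvariant_partitionFunction pderiv_partitionFunction
  coeff_virasoro)

/-- The linear functional sending the monomial `∏ p_{dᵢ}` to the coefficient at `(d₁, …, dₙ)` of the
partition function. -/
noncomputable def bracket : MvPolynomial ℕ ℚ →ₗ[ℚ] ℚ :=
  (basisMonomials ℕ ℚ).constr ℚ fun m => coeff m.toMultiset.toList partitionFunction

theorem prod_map_X (l : List ℕ) :
    (l.map (X : ℕ → MvPolynomial ℕ ℚ)).prod =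
      basisMonomials ℕ ℚ (Multiset.toFinsupp (l : Multiset ℕ)) := by
  rw [coe_basisMonomials]
  induction l with
  | nil => simp
  | cons s l ih =>
    rw [List.map_cons, List.prod_cons, ih, X, monomial_mul, one_mul, ← Multiset.cons_coe,
      ← Multiset.singleton_add, map_add, Multiset.toFinsupp_singleton]

theorem bracket_prod_map_X (l : List ℕ) :
    bracket (l.map X).prod = coeff l partitionFunction := by
  rw [prod_map_X, bracket, Module.Basis.constr_basis, Multiset.toFinsupp_toMultiset]
  exact permInvariant_partitionFunction (Multiset.coe_eq_coe.1 (Multiset.coe_toList _))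

theorem raise_prod_map_X (d : ℕ) (l : List ℕ) :
    raise d (l.map X).prod = ∑ i : Fin l.length,
      (2 * (l.get i : ℚ) + 1) • ((l.set i (l.get i + d)).map X).prod := by
  induction l with
  | nil => simp
  | cons s l ih =>
    simp [Fin.sum_univ_succ, raise_X, ih, Finset.mul_sum, add_comm, mul_comm]

theorem isVirasoroFunctional_bracket : IsVirasoroFunctional bracket where
  map_one := by simpa [coeff_nil_exp, partitionFunction] using bracket_prod_map_X []
  map_X_mul d f := by
    suffices h : bracket ∘ₗ LinearMap.mulLeft ℚ (X d) =
        bracket ∘ₗ ((raise d).toLinearMap + LinearMap.mulLeft ℚ (quadratic d)) from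
      LinearMap.congr_fun h f
    refine (basisMonomials ℕ ℚ).ext fun m => ?_
    obtain ⟨l, rfl⟩ : ∃ l : List ℕ, Multiset.toFinsupp (l : Multiset ℕ) = m :=
      ⟨m.toMultiset.toList, by rw [Multiset.coe_toList, Finsupp.toMultiset_toFinsupp]⟩
    rw [← prod_map_X]
    have hcons (a : ℕ) (w : List ℕ) :
        X a * (w.map (X : ℕ → MvPolynomial ℕ ℚ)).prod = ((a :: w).map X).prod := by
      rw [List.map_cons, List.prod_cons]
    have hquad : quadratic d * (l.map (X : ℕ → MvPolynomial ℕ ℚ)).prod =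
        (1 / 2 : ℚ) • ∑ a ∈ Finset.range d, ((a :: (d - 1 - a) :: l).map X).prod
          + anomaly d • (l.map X).prod := by
      simp only [quadratic, add_mul, smul_mul_assoc, Finset.sum_mul, one_mul, mul_assoc, hcons]
    simp only [LinearMap.comp_apply, LinearMap.add_apply, LinearMap.mulLeft_apply,
      Derivation.coeFn_coe, hcons, hquad, raise_prod_map_X, map_add, map_sum, map_smul,
      bracket_prod_map_X, smul_eq_mul]
    rw [coeff_cons, pderiv_partitionFunction, coeff_virasoro, add_assoc]

theorem bracket_X (k : ℕ) : bracket (X k) = B [k] := by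
  have h := bracket_prod_map_X [k]
  rw [List.map_singleton, List.prod_singleton] at h
  rw [h, coeff_cons, partitionFunction, pderiv_exp, coeff_nil_mul, coeff_nil_exp, mul_one]
  rfl

end OddPowerSum

namespace BGW

theorem B_singleton_succ (k : ℕ) :
    8 * ((k : ℚ) + 2) * B [k + 1] = (2 * (k : ℚ) + 3) ^ 2 * (2 * k + 1) * B [k] := by
  simpa only [OddPowerSum.bracket_X] using OddPowerSum.isVirasoroFunctional_bracket.map_X_succ k

end BGW

/-! ### Normalized numbers -/

namespace BGW

open scoped Nat Real

/-- The normalized BGW numbers as a function of a list of indices. -/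
noncomputable def normalizedB (l : List ℕ) : ℝ :=
  2 ^ (2 * l.sum + 1) * (B l : ℝ) / ((weight l - 1)! : ℝ)

theorem weight_eq (l : List ℕ) : weight l = 2 * l.sum + l.length := by
  induction l with
  | nil => rfl
  | cons s l ih => rw [weight_cons, ih, List.sum_cons, List.length_cons]; ring

theorem sum_two_mul_get_add_one (l : List ℕ) :
    ∑ i : Fin l.length, (2 * (l.get i : ℝ) + 1) = weight l := by
  rw [weight, ← Fin.sum_univ_fun_getElem]
  push_cast
  rfl

theorem two_le_weight_cons {d : ℕ} {l : List ℕ} (h : ¬(d = 0 ∧ l = [])) :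
    2 ≤ weight (d :: l) := by
  rw [weight_cons, weight_eq]
  have : l ≠ [] → 0 < l.length := List.length_pos_iff.2
  grind

theorem normalizedB_perm {l l' : List ℕ} (h : l.Perm l') : normalizedB l = normalizedB l' := by
  rw [normalizedB, normalizedB, B_perm h, weight_perm h, h.sum_eq]

theorem B_nonneg (l : List ℕ) : 0 ≤ B l := by
  induction l using B.induct with
  | case1 => rw [B]
  | case2 d l h => rw [B, if_pos h]; norm_num
  | case3 d l h ih₁ ih₂ ih₃ ih₄ =>
    rw [B, if_neg h]
    have hraise : 0 ≤ ∑ i : Fin l.length,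
        (2 * (l.get i : ℚ) + 1) * B (l.set i (l.get i + d)) :=
      Finset.sum_nonneg fun i _ => mul_nonneg (by positivity) (ih₁ i)
    have hsplit (a : Fin d) : 0 ≤ ∑ I : Finset (Fin l.length),
        B ((a : ℕ) :: subseq l I) * B ((d - 1 - (a : ℕ)) :: subseq l Iᶜ) :=
      Finset.sum_nonneg fun I _ => mul_nonneg (ih₃ a I) (ih₄ a I)
    have hquad := Finset.sum_nonneg fun a (_ : a ∈ Finset.univ) => add_nonneg (ih₂ a) (hsplit a)
    linarith

theorem normalizedB_nonneg (l : List ℕ) : 0 ≤ normalizedB l := by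
  have : (0 : ℝ) ≤ B l := by exact_mod_cast B_nonneg l
  unfold normalizedB
  positivity

theorem sum_subseq (l : List ℕ) (I : Finset (Fin l.length)) :
    (subseq l I).sum = ∑ i ∈ I, l.get i := by
  rw [subseq, ← List.sum_toFinset _ ((List.nodup_finRange _).filter _)]
  congr 1
  ext i
  simp

theorem sum_subseq_add_sum_subseq_compl (l : List ℕ) (I : Finset (Fin l.length)) :
    (subseq l I).sum + (subseq l Iᶜ).sum = l.sum := by
  rw [sum_subseq, sum_subseq, Finset.sum_add_sum_compl]
  simp [Fin.sum_univ_getElem]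

theorem length_subseq (l : List ℕ) (I : Finset (Fin l.length)) :
    (subseq l I).length = I.card := by
  rw [subseq, List.length_map, ← List.toFinset_card_of_nodup ((List.nodup_finRange _).filter _)]
  congr 1
  ext i
  simp

/-- The term of the recursion for the normalized numbers in which the first index splits into `a`
and `d - 1 - a`, and the other indices into `I` and its complement. -/
noncomputable def splitTerm (d : ℕ) (l : List ℕ) (a : ℕ) (I : Finset (Fin l.length)) : ℝ :=
  ((weight (a :: subseq l I) - 1)! : ℝ) * ((weight ((d - 1 - a) :: subseq l Iᶜ) - 1)! : ℝ)
    / ((weight (d :: l) - 2)! : ℝ)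
    * (normalizedB (a :: subseq l I) * normalizedB ((d - 1 - a) :: subseq l Iᶜ))

/-- The part of the recursion for the normalized numbers that is quadratic in them. -/
noncomputable def quadraticTerm (d : ℕ) (l : List ℕ) : ℝ :=
  ∑ a ∈ Finset.range d, ∑ I : Finset (Fin l.length), splitTerm d l a I

theorem B_cons_cast {d : ℕ} {l : List ℕ} (h : ¬(d = 0 ∧ l = [])) :
    (B (d :: l) : ℝ) =
      ∑ i : Fin l.length, (2 * (l.get i : ℝ) + 1) * (B (l.set i (l.get i + d)) : ℝ)
      + 1 / 2 * ∑ a ∈ Finset.range d, (B (a :: (d - 1 - a) :: l) : ℝ)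
      + 1 / 2 * ∑ a ∈ Finset.range d, ∑ I : Finset (Fin l.length),
          (B (a :: subseq l I) : ℝ) * (B ((d - 1 - a) :: subseq l Iᶜ) : ℝ) := by
  rw [B, if_neg h]
  push_cast
  rw [Finset.sum_add_distrib, Finset.sum_range, Finset.sum_range]
  ring

theorem weight_sub_one_mul_normalizedB {l : List ℕ} (hl : 2 ≤ weight l) :
    ((weight l : ℝ) - 1) * normalizedB l =
      2 ^ (2 * l.sum + 1) / ((weight l - 2)! : ℝ) * B l := by
  obtain ⟨w, hw⟩ := Nat.exists_eq_add_of_le' hl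
  rw [normalizedB, hw, Nat.add_sub_cancel, show w + 2 - 1 = w + 1 by rfl, Nat.factorial_succ]
  push_cast
  field_simp
  ring

theorem B_eq_normalizedB (l : List ℕ) :
    (B l : ℝ) = normalizedB l * ((weight l - 1)! : ℝ) / 2 ^ (2 * l.sum + 1) := by
  rw [normalizedB]
  field_simp

theorem normalizedB_set_add (d : ℕ) (l : List ℕ) (i : Fin l.length) :
    normalizedB (l.set i (l.get i + d)) =
      2 ^ (2 * (d :: l).sum + 1) / ((weight (d :: l) - 2)! : ℝ) * B (l.set i (l.get i + d)) := by
  have hweight := weight_cons d l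
  have hw := weight_set l i d
  have hs := weight_eq (l.set i (l.get i + d))
  rw [List.length_set, hw, weight_eq l] at hs
  rw [normalizedB, hw, show weight l + 2 * d - 1 = weight (d :: l) - 2 by lia, List.sum_cons,
    show (l.set i (l.get i + d)).sum = d + l.sum by lia]
  ring

theorem two_mul_normalizedB_cons_cons {d a : ℕ} (ha : a < d) (l : List ℕ) :
    2 * normalizedB (a :: (d - 1 - a) :: l) =
      2 ^ (2 * (d :: l).sum + 1) / ((weight (d :: l) - 2)! : ℝ)
        * (1 / 2 * B (a :: (d - 1 - a) :: l)) := by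
  have hw : weight (a :: (d - 1 - a) :: l) - 1 = weight (d :: l) - 2 := by
    simp only [weight_cons]; lia
  have hs : 2 * (d :: l).sum + 1 = (2 * (a :: (d - 1 - a) :: l).sum + 1) + 2 := by
    simp only [List.sum_cons]; lia
  rw [normalizedB, hw, hs, pow_add]
  ring

theorem weight_sub_one_mul_normalizedB_cons {d : ℕ} {l : List ℕ} (h : ¬(d = 0 ∧ l = [])) :
    ((weight (d :: l) : ℝ) - 1) * normalizedB (d :: l) =
      ∑ i : Fin l.length, (2 * (l.get i : ℝ) + 1) * normalizedB (l.set i (l.get i + d))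
      + 2 * ∑ a ∈ Finset.range d, normalizedB (a :: (d - 1 - a) :: l) + quadraticTerm d l := by
  have hsplit {a : ℕ} (ha : a ∈ Finset.range d) (I : Finset (Fin l.length)) :
      2 * (d :: l).sum + 1 = (2 * (a :: subseq l I).sum + 1)
        + (2 * ((d - 1 - a) :: subseq l Iᶜ).sum + 1) + 1 := by
    have hs := sum_subseq_add_sum_subseq_compl l I
    simp only [Finset.mem_range, List.sum_cons] at ha ⊢
    lia
  simp only [weight_sub_one_mul_normalizedB (two_le_weight_cons h), B_cons_cast h, mul_add,
    quadraticTerm, splitTerm, normalizedB_set_add, Finset.mul_sum, Finset.sum_congr rfl fun _ ha =>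
      two_mul_normalizedB_cons_cons (Finset.mem_range.1 ha) l]
  congr 1
  · congr 1
    exact Finset.sum_congr rfl fun i _ => by ring
  · refine Finset.sum_congr rfl fun a ha => Finset.sum_congr rfl fun I _ => ?_
    rw [B_eq_normalizedB (a :: _), B_eq_normalizedB ((d - 1 - a) :: _), hsplit ha I, pow_succ,
      pow_add]
    field_simp

theorem normalizedB_zero_cons {l : List ℕ} (hl : l ≠ []) :
    normalizedB (0 :: l) = normalizedB l := by
  have hrec := weight_sub_one_mul_normalizedB_cons (d := 0) fun h => hl h.2
  have hpos : (0 : ℝ) < weight l := by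
    rw [weight_eq]
    have := List.length_pos_iff.2 hl
    exact_mod_cast (by lia)
  simp only [quadraticTerm, Finset.range_zero, Finset.sum_empty, add_zero, mul_zero,
    List.get_eq_getElem, List.set_getElem_self, ← Finset.sum_mul] at hrec
  simp only [← List.get_eq_getElem, sum_two_mul_get_add_one, weight_cons] at hrec
  push_cast at hrec
  refine mul_left_cancel₀ hpos.ne' ?_
  linear_combination hrec

/-! ### Asymptotics of the one-point numbers -/

theorem normalizedB_singleton_zero : normalizedB [0] = 1 / 4 := by
  rw [normalizedB, B_zero]
  norm_num [weight]

theorem normalizedB_singleton_succ (k : ℕ) :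
    normalizedB [k + 1] =
      (2 * (k : ℝ) + 3) ^ 2 / ((2 * k + 2) * (2 * k + 4)) * normalizedB [k] := by
  have hB : 8 * ((k : ℝ) + 2) * B [k + 1] = (2 * (k : ℝ) + 3) ^ 2 * (2 * k + 1) * B [k] := by
    exact_mod_cast B_singleton_succ k
  rw [normalizedB, normalizedB, weight_eq, weight_eq]
  simp only [List.sum_singleton, List.length_singleton, Nat.add_sub_cancel]
  rw [mul_add_one 2 k, Nat.factorial_succ, Nat.factorial_succ]
  push_cast
  field_simp
  linear_combination 2 ^ (2 * k + 1) * (2 * (k : ℝ) + 2) * hB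

theorem normalizedB_singleton_mul_wallis (k : ℕ) :
    normalizedB [k] * Real.Wallis.W k = (2 * (k : ℝ) + 1) / (2 * (2 * k + 2)) := by
  induction k with
  | zero => norm_num [normalizedB_singleton_zero, Real.Wallis.W]
  | succ k ih =>
    rw [normalizedB_singleton_succ, Real.Wallis.W_succ]
    push_cast
    field_simp at ih ⊢
    linear_combination (2 * (k : ℝ) + 3) * (2 * k + 4) * ih

theorem normalizedB_singleton_le (k : ℕ) : normalizedB [k] ≤ 1 / π := by
  refine le_of_mul_le_mul_right ?_ (Real.Wallis.W_pos k)
  calc normalizedB [k] * Real.Wallis.W k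
      = 1 / π * ((2 * (k : ℝ) + 1) / (2 * k + 2) * (π / 2)) := by
        rw [normalizedB_singleton_mul_wallis]
        field_simp
    _ ≤ 1 / π * Real.Wallis.W k := by gcongr; exact Real.Wallis.le_W k

theorem le_normalizedB_singleton (k : ℕ) :
    (2 * (k : ℝ) + 1) / (2 * k + 2) * (1 / π) ≤ normalizedB [k] := by
  refine le_of_mul_le_mul_right ?_ (Real.Wallis.W_pos k)
  calc (2 * (k : ℝ) + 1) / (2 * k + 2) * (1 / π) * Real.Wallis.W k
      ≤ (2 * (k : ℝ) + 1) / (2 * k + 2) * (1 / π) * (π / 2) := by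
        gcongr; exact Real.Wallis.W_le k
    _ = normalizedB [k] * Real.Wallis.W k := by
        rw [normalizedB_singleton_mul_wallis]
        field_simp

theorem one_div_pi_le_one : 1 / π ≤ 1 := by
  rw [div_le_one Real.pi_pos]
  linarith [Real.pi_gt_three]

theorem abs_normalizedB_singleton_sub_le (k : ℕ) :
    |normalizedB [k] - 1 / π| ≤ 1 / ((k : ℝ) + 1) := by
  have hgap : 1 / π - (2 * (k : ℝ) + 1) / (2 * k + 2) * (1 / π) =
      1 / 2 * (1 / π) * (1 / ((k : ℝ) + 1)) := by
    field_simp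
    ring
  have hle : 1 / 2 * (1 / π) * (1 / ((k : ℝ) + 1)) ≤ 1 / ((k : ℝ) + 1) :=
    mul_le_of_le_one_left (by positivity) (by linarith [one_div_pi_le_one])
  have hpos : (0 : ℝ) ≤ 1 / ((k : ℝ) + 1) := by positivity
  rw [abs_le]
  constructor <;> linarith [normalizedB_singleton_le k, le_normalizedB_singleton k]

/-! ### The quadratic term -/

theorem mul_add_one_le_choose (p q : ℕ) : p * q + 1 ≤ (p + q).choose p := by
  induction p generalizing q with
  | zero => simp
  | succ p ihp =>
    induction q with
    | zero => simp
    | succ q ihq =>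
      rw [← add_assoc, Nat.choose_succ_succ]
      have := ihp (q + 1)
      rw [← add_assoc, add_right_comm p q 1] at this
      nlinarith

theorem choose_mul_choose_le (m n i j : ℕ) :
    m.choose i * n.choose j ≤ (m + n).choose (i + j) := by
  rw [Nat.add_choose_eq]
  exact Finset.single_le_sum (f := fun ij : ℕ × ℕ => m.choose ij.1 * n.choose ij.2)
    (fun _ _ => Nat.zero_le _) ((Finset.HasAntidiagonal.mem_antidiagonal (a := (i, j))).2 rfl)

theorem mul_mul_le_four_mul_choose {p q : ℕ} (hp : 0 < p) (hq : 0 < q) :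
    (p + 1) * (q + 1) * (p + q + 1) ≤ 4 * (2 * p + 2 * q).choose (2 * p) := by
  have hsum : p + q ≤ p * q + 1 := by nlinarith
  have hchoose := mul_add_one_le_choose p q
  calc (p + 1) * (q + 1) * (p + q + 1)
      ≤ 2 * (p * q + 1) * (2 * (p * q + 1)) := Nat.mul_le_mul (by lia) (by lia)
    _ ≤ 2 * (p + q).choose p * (2 * (p + q).choose p) := by gcongr
    _ = 4 * ((p + q).choose p * (p + q).choose p) := by ring
    _ ≤ 4 * (2 * p + 2 * q).choose (2 * p) := by
        have := choose_mul_choose_le (p + q) (p + q) p p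
        rw [← two_mul, ← two_mul, mul_add] at this
        gcongr

theorem sum_one_div_choose_card (n : ℕ) :
    ∑ I : Finset (Fin n), 1 / (n.choose I.card : ℝ) = n + 1 := by
  rw [← Finset.powerset_univ, Finset.sum_powerset_apply_card fun k => 1 / (n.choose k : ℝ),
    Finset.card_fin, Finset.sum_congr rfl (g := fun _ => (1 : ℝ)) fun k hk => ?_]
  · simp
  · have : n.choose k ≠ 0 := (Nat.choose_pos (Finset.mem_range_succ_iff.1 hk)).ne'
    rw [nsmul_eq_mul, mul_one_div_cancel (mod_cast this)]

theorem factorial_mul_factorial_div_factorial (x y : ℕ) :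
    ((x ! : ℝ) * y !) / ((x + y + 1)! : ℝ) =
      1 / ((x : ℝ) + y + 1) * (1 / ((x + y).choose x : ℝ)) := by
  have h : ((x + y).choose x : ℝ) * x ! * y ! = (x + y)! := by
    rw [Nat.choose_symm_add]
    exact_mod_cast Nat.add_choose_mul_factorial_mul_factorial x y
  have hpos : ((x + y).choose x : ℝ) ≠ 0 := mod_cast (Nat.choose_pos le_self_add).ne'
  rw [Nat.factorial_succ]
  push_cast
  rw [← h]
  field_simp

theorem subseq_empty (l : List ℕ) : subseq l ∅ = [] := by simp [subseq]

theorem subseq_univ (l : List ℕ) : subseq l Finset.univ = l := by simp [subseq]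

theorem eq_empty_of_sum_subseq_eq_zero {l : List ℕ} (hl : 0 ∉ l) {I : Finset (Fin l.length)}
    (h : (subseq l I).sum = 0) : I = ∅ := by
  rw [sum_subseq, Finset.sum_eq_zero_iff] at h
  exact Finset.eq_empty_of_forall_notMem fun i hi => hl (h i hi ▸ List.get_mem l i)

theorem weight_cons_subseq_add {d a : ℕ} (ha : a < d) (l : List ℕ) (I : Finset (Fin l.length)) :
    weight (a :: subseq l I) + weight ((d - 1 - a) :: subseq l Iᶜ) + 1 = weight (d :: l) := by
  have hsum := sum_subseq_add_sum_subseq_compl l I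
  have hcard := Finset.card_add_card_compl I
  rw [Fintype.card_fin] at hcard
  simp only [weight_eq, List.sum_cons, List.length_cons, length_subseq]
  lia

theorem splitTerm_nonneg (d : ℕ) (l : List ℕ) (a : ℕ) (I : Finset (Fin l.length)) :
    0 ≤ splitTerm d l a I :=
  mul_nonneg (by positivity) (mul_nonneg (normalizedB_nonneg _) (normalizedB_nonneg _))

theorem quadraticTerm_nonneg (d : ℕ) (l : List ℕ) : 0 ≤ quadraticTerm d l :=
  Finset.sum_nonneg fun _ _ => Finset.sum_nonneg fun _ _ => splitTerm_nonneg ..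

theorem splitTerm_compl {d a : ℕ} (ha : a < d) (l : List ℕ) (I : Finset (Fin l.length)) :
    splitTerm d l (d - 1 - a) Iᶜ = splitTerm d l a I := by
  rw [splitTerm, splitTerm, compl_compl, show d - 1 - (d - 1 - a) = a by lia]
  ring

theorem splitTerm_eq {d a : ℕ} (ha : a < d) (l : List ℕ) (I : Finset (Fin l.length)) :
    splitTerm d l a I = 1 / ((weight (d :: l) : ℝ) - 2)
      * (1 / ((weight (d :: l) - 3).choose (weight (a :: subseq l I) - 1) : ℝ)
        * (normalizedB (a :: subseq l I) * normalizedB ((d - 1 - a) :: subseq l Iᶜ))) := by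
  have hweight := weight_cons_subseq_add ha l I
  obtain ⟨x, hx⟩ : ∃ x, weight (a :: subseq l I) = x + 1 :=
    Nat.exists_eq_add_of_le' (by rw [weight_cons]; lia)
  obtain ⟨y, hy⟩ : ∃ y, weight ((d - 1 - a) :: subseq l Iᶜ) = y + 1 :=
    Nat.exists_eq_add_of_le' (by rw [weight_cons]; lia)
  obtain hw : weight (d :: l) = x + y + 3 := by lia
  rw [splitTerm, hx, hy, hw, show x + y + 3 - 2 = x + y + 1 by lia, Nat.add_sub_cancel,
    Nat.add_sub_cancel, Nat.add_sub_cancel, factorial_mul_factorial_div_factorial, mul_assoc]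
  congr 2
  push_cast
  ring

theorem splitTerm_zero_empty {d : ℕ} (hd : 0 < d) (l : List ℕ) :
    splitTerm d l 0 ∅ =
      1 / ((weight (d :: l) : ℝ) - 2) * (normalizedB ((d - 1) :: l) / 4) := by
  rw [splitTerm_eq hd, subseq_empty, Finset.compl_empty, subseq_univ, normalizedB_singleton_zero,
    show weight [0] - 1 = 0 by rfl, Nat.choose_zero_right, Nat.sub_zero]
  ring

theorem one_div_choose_mul_le {p q n i : ℕ} (hp : 0 < p) (hq : 0 < q) (hi : i ≤ n) :
    1 / ((2 * p + 2 * q + n).choose (2 * p + i) : ℝ) * (((p : ℝ) + 1) / 4 * (((q : ℝ) + 1) / 4)) ≤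
      1 / (4 * ((p : ℝ) + q + 1)) * (1 / (n.choose i : ℝ)) := by
  have hn : 0 < n.choose i := Nat.choose_pos hi
  have hpq : 0 < (2 * p + 2 * q).choose (2 * p) := Nat.choose_pos le_self_add
  have hbinom : ((p : ℝ) + 1) * (q + 1) * (p + q + 1) ≤
      4 * ((2 * p + 2 * q).choose (2 * p) : ℝ) := mod_cast mul_mul_le_four_mul_choose hp hq
  calc _ ≤ 1 / (((2 * p + 2 * q).choose (2 * p) : ℝ) * (n.choose i : ℝ))
          * (((p : ℝ) + 1) / 4 * (((q : ℝ) + 1) / 4)) := by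
        gcongr
        exact_mod_cast choose_mul_choose_le _ _ _ _
    _ = ((p : ℝ) + 1) * (q + 1) / (16 * ((2 * p + 2 * q).choose (2 * p) : ℝ))
          * (1 / (n.choose i : ℝ)) := by
        field_simp
        ring
    _ ≤ _ := by
        refine mul_le_mul_of_nonneg_right ?_ (by positivity)
        rw [div_le_div_iff₀ (by positivity) (by positivity)]
        linarith

theorem splitTerm_le {d a : ℕ} (ha : a < d) {l : List ℕ} {I : Finset (Fin l.length)}
    (hI : 0 < (a :: subseq l I).sum) (hIc : 0 < ((d - 1 - a) :: subseq l Iᶜ).sum)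
    (hbound : normalizedB (a :: subseq l I) ≤ (((a :: subseq l I).sum : ℝ) + 1) / 4)
    (hboundc : normalizedB ((d - 1 - a) :: subseq l Iᶜ) ≤
      ((((d - 1 - a) :: subseq l Iᶜ).sum : ℝ) + 1) / 4) :
    splitTerm d l a I ≤ 1 / ((weight (d :: l) : ℝ) - 2)
      * (1 / (4 * ((d : ℝ) + l.sum)) * (1 / (l.length.choose I.card : ℝ))) := by
  have hcard := I.card_add_card_compl
  have hweight := weight_cons_subseq_add ha l I
  have hsum := sum_subseq_add_sum_subseq_compl l I
  have hwI := weight_eq (a :: subseq l I)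
  have hwIc := weight_eq ((d - 1 - a) :: subseq l Iᶜ)
  rw [Fintype.card_fin] at hcard
  rw [List.length_cons, length_subseq] at hwI hwIc
  have hpq : (a :: subseq l I).sum + ((d - 1 - a) :: subseq l Iᶜ).sum + 1 = d + l.sum := by
    simp only [List.sum_cons]
    lia
  have hw : (0 : ℝ) ≤ weight (d :: l) - 2 := sub_nonneg.2 (mod_cast (by lia))
  have hprod := mul_le_mul hbound hboundc (normalizedB_nonneg _) (by positivity)
  rw [splitTerm_eq ha]
  set p := (a :: subseq l I).sum
  set q := ((d - 1 - a) :: subseq l Iᶜ).sum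
  refine mul_le_mul_of_nonneg_left ?_ (one_div_nonneg.2 hw)
  refine (mul_le_mul_of_nonneg_left hprod (by positivity)).trans ?_
  rw [show weight (d :: l) - 3 = 2 * p + 2 * q + l.length by lia,
    show weight (a :: subseq l I) - 1 = 2 * p + I.card by lia, ← Nat.cast_add d, ← hpq]
  push_cast
  exact one_div_choose_mul_le hI hIc (by lia)

theorem splitTerm_le_add {d a : ℕ} (ha : a < d) {l : List ℕ} (hl : 0 ∉ l)
    (hbound : ∀ t, t ≠ [] → weight t < weight (d :: l) → normalizedB t ≤ ((t.sum : ℝ) + 1) / 4)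
    (I : Finset (Fin l.length)) :
    splitTerm d l a I ≤
      (if a = 0 then if I = ∅ then splitTerm d l 0 ∅ else 0 else 0)
      + (if a = d - 1 then if I = Finset.univ then splitTerm d l 0 ∅ else 0 else 0)
      + 1 / ((weight (d :: l) : ℝ) - 2)
        * (1 / (4 * ((d : ℝ) + l.sum)) * (1 / (l.length.choose I.card : ℝ))) := by
  have hweight := weight_cons_subseq_add ha l I
  have hsplit := splitTerm_nonneg d l 0 ∅
  have hw : (0 : ℝ) ≤ weight (d :: l) - 2 :=
    sub_nonneg.2 (mod_cast two_le_weight_cons (by lia))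
  have hfirst : 0 ≤ if a = 0 then if I = ∅ then splitTerm d l 0 ∅ else 0 else 0 := by
    split_ifs <;> positivity
  have hlast : 0 ≤ if a = d - 1 then if I = Finset.univ then splitTerm d l 0 ∅ else 0 else 0 := by
    split_ifs <;> positivity
  have hgeneric : 0 ≤ 1 / ((weight (d :: l) : ℝ) - 2)
      * (1 / (4 * ((d : ℝ) + l.sum)) * (1 / (l.length.choose I.card : ℝ))) := by positivity
  rcases (a :: subseq l I).sum.eq_zero_or_pos with hI | hI
  · rw [List.sum_cons, Nat.add_eq_zero_iff] at hI
    obtain ⟨rfl, hI⟩ := hI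
    obtain rfl := eq_empty_of_sum_subseq_eq_zero hl hI
    rw [if_pos rfl, if_pos rfl]
    linarith
  rcases ((d - 1 - a) :: subseq l Iᶜ).sum.eq_zero_or_pos with hIc | hIc
  · rw [List.sum_cons, Nat.add_eq_zero_iff] at hIc
    obtain ⟨had, hIc⟩ := hIc
    have hIc := eq_empty_of_sum_subseq_eq_zero hl hIc
    rw [← splitTerm_compl ha, had, hIc, if_pos (by lia : a = d - 1),
      if_pos (Finset.compl_eq_empty_iff I |>.1 hIc)]
    linarith
  · have hlt : weight (a :: subseq l I) < weight (d :: l) := by lia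
    have hltc : weight ((d - 1 - a) :: subseq l Iᶜ) < weight (d :: l) := by lia
    have hle := splitTerm_le ha hI hIc (hbound _ (List.cons_ne_nil _ _) hlt)
      (hbound _ (List.cons_ne_nil _ _) hltc)
    linarith

theorem quadraticTerm_le {d : ℕ} (hd : 0 < d) {l : List ℕ} (hl : 0 ∉ l)
    (hbound : ∀ t, t ≠ [] → weight t < weight (d :: l) → normalizedB t ≤ ((t.sum : ℝ) + 1) / 4)
    (hmin : d * (l.length + 1) ≤ d + l.sum) :
    quadraticTerm d l ≤
      (normalizedB ((d - 1) :: l) / 2 + 1 / 4) / ((weight (d :: l) : ℝ) - 2) := by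
  have hw : (0 : ℝ) ≤ weight (d :: l) - 2 :=
    sub_nonneg.2 (mod_cast two_le_weight_cons (by lia))
  have hmin' : (d : ℝ) * (1 / (4 * (d + l.sum)) * (l.length + 1)) ≤ 1 / 4 := by
    have : (d : ℝ) * (l.length + 1) ≤ d + l.sum := mod_cast hmin
    rw [mul_left_comm, one_div_mul_eq_div, div_le_div_iff₀ (by positivity) (by positivity)]
    linarith
  have hfirst (c : ℝ) : ∑ a ∈ Finset.range d, ∑ I : Finset (Fin l.length),
      (if a = 0 then if I = ∅ then c else 0 else 0) = c := by
    rw [Finset.sum_eq_single_of_mem 0 (Finset.mem_range.2 hd) fun a _ ha => by simp [ha]]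
    simp
  have hlast (c : ℝ) : ∑ a ∈ Finset.range d, ∑ I : Finset (Fin l.length),
      (if a = d - 1 then if I = Finset.univ then c else 0 else 0) = c := by
    rw [Finset.sum_eq_single_of_mem (d - 1) (Finset.mem_range.2 (by lia))
      fun a _ ha => by simp [ha]]
    simp
  have hsum := Finset.sum_le_sum fun a ha => Finset.sum_le_sum fun I (_ : I ∈ Finset.univ) =>
    splitTerm_le_add (Finset.mem_range.1 ha) hl hbound I
  simp only [Finset.sum_add_distrib, hfirst, hlast, ← Finset.mul_sum, sum_one_div_choose_card,
    Finset.sum_const, Finset.card_range, nsmul_eq_mul, splitTerm_zero_empty hd] at hsum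
  calc quadraticTerm d l
      ≤ 1 / ((weight (d :: l) : ℝ) - 2) * (normalizedB ((d - 1) :: l) / 2
          + d * (1 / (4 * (d + l.sum)) * (l.length + 1))) := hsum.trans_eq (by ring)
    _ ≤ 1 / ((weight (d :: l) : ℝ) - 2) * (normalizedB ((d - 1) :: l) / 2 + 1 / 4) := by gcongr
    _ = _ := one_div_mul_eq_div _ _

/-! ### Averaging and the a priori bound -/

theorem abs_normalizedB_cons_sub_le {d : ℕ} {l : List ℕ} (h : ¬(d = 0 ∧ l = [])) {c U V : ℝ}
    (hU : ∀ i : Fin l.length, |normalizedB (l.set i (l.get i + d)) - c| ≤ U)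
    (hV : ∀ a < d, |normalizedB (a :: (d - 1 - a) :: l) - c| ≤ V) :
    ((weight (d :: l) : ℝ) - 1) * |normalizedB (d :: l) - c| ≤
      weight l * U + 2 * d * V + quadraticTerm d l := by
  have hw : (weight (d :: l) : ℝ) - 1 = weight l + 2 * d := by
    rw [weight_cons]; push_cast; ring
  have hdiff : ((weight (d :: l) : ℝ) - 1) * (normalizedB (d :: l) - c) =
      ∑ i : Fin l.length, (2 * (l.get i : ℝ) + 1) * (normalizedB (l.set i (l.get i + d)) - c)
      + 2 * ∑ a ∈ Finset.range d, (normalizedB (a :: (d - 1 - a) :: l) - c)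
      + quadraticTerm d l := by
    simp only [mul_sub, Finset.sum_sub_distrib, ← Finset.sum_mul, sum_two_mul_get_add_one,
      weight_sub_one_mul_normalizedB_cons h, Finset.sum_const, Finset.card_range, nsmul_eq_mul]
    rw [hw]
    ring
  have hraise : |∑ i : Fin l.length,
      (2 * (l.get i : ℝ) + 1) * (normalizedB (l.set i (l.get i + d)) - c)| ≤ weight l * U := by
    rw [← sum_two_mul_get_add_one, Finset.sum_mul]
    refine (Finset.abs_sum_le_sum_abs _ _).trans (Finset.sum_le_sum fun i _ => ?_)
    rw [abs_mul, abs_of_nonneg (by positivity : (0 : ℝ) ≤ 2 * (l.get i : ℝ) + 1)]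
    exact mul_le_mul_of_nonneg_left (hU i) (by positivity)
  have hpair : |2 * ∑ a ∈ Finset.range d, (normalizedB (a :: (d - 1 - a) :: l) - c)| ≤
      2 * d * V := by
    rw [abs_mul, abs_two, mul_assoc]
    gcongr
    refine (Finset.abs_sum_le_sum_abs _ _).trans ?_
    refine (Finset.sum_le_sum fun a ha => hV a (Finset.mem_range.1 ha)).trans_eq ?_
    rw [Finset.sum_const, Finset.card_range, nsmul_eq_mul]
  rw [← abs_of_nonneg (by rw [hw]; positivity : (0 : ℝ) ≤ weight (d :: l) - 1), ← abs_mul, hdiff]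
  refine (abs_add_le _ _).trans (add_le_add ((abs_add_le _ _).trans (add_le_add hraise hpair)) ?_)
  rw [abs_of_nonneg (quadraticTerm_nonneg d l)]

theorem exists_perm_min_cons {l : List ℕ} (hl : l ≠ []) :
    ∃ d t, l.Perm (d :: t) ∧ d * (t.length + 1) ≤ d + t.sum := by
  obtain ⟨a, ha⟩ := List.exists_mem_of_ne_nil l hl
  obtain ⟨d, hd, hmin⟩ := l.toFinset.exists_min_image id ⟨a, List.mem_toFinset.2 ha⟩
  refine ⟨d, l.erase d, List.perm_cons_erase (List.mem_toFinset.1 hd), ?_⟩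
  have hsum := List.card_nsmul_le_sum (l.erase d) d
    fun x hx => hmin x (List.mem_toFinset.2 (List.mem_of_mem_erase hx))
  rw [smul_eq_mul] at hsum
  linarith

/-- The numbers are symmetric and ignore zeros next to other indices, so the recursion need only be
applied to a minimal positive index `d`. -/
theorem induction_on_weight {P : List ℕ → Prop}
    (perm : ∀ {l l' : List ℕ}, l.Perm l' → P l' → P l) (singleton_zero : P [0])
    (zero_cons : ∀ {l : List ℕ}, l ≠ [] → P l → P (0 :: l))
    (min_cons : ∀ {d : ℕ} {l : List ℕ}, 0 < d → 0 ∉ l → d * (l.length + 1) ≤ d + l.sum →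
      (∀ t, t ≠ [] → weight t < weight (d :: l) → P t) → P (d :: l))
    {l : List ℕ} (hl : l ≠ []) : P l := by
  induction hw : weight l using Nat.strong_induction_on generalizing l with
  | _ w ih =>
    subst hw
    by_cases h0 : 0 ∈ l
    · have hperm := List.perm_cons_erase h0
      rcases eq_or_ne (l.erase 0) [] with hnil | hne
      · exact perm (hnil ▸ hperm) singleton_zero
      · have hlt : weight (l.erase 0) < weight l := by
          rw [weight_perm hperm, weight_cons]; lia
        exact perm hperm (zero_cons hne (ih _ hlt hne rfl))
    · obtain ⟨d, t, hperm, hmin⟩ := exists_perm_min_cons hl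
      rw [hperm.mem_iff, List.mem_cons, not_or] at h0
      refine perm hperm (min_cons (Nat.pos_of_ne_zero (Ne.symm h0.1)) h0.2 hmin ?_)
      exact fun s hs hlt => ih _ (weight_perm hperm ▸ hlt) hs rfl

theorem sum_set_add (l : List ℕ) (i : Fin l.length) (d : ℕ) :
    (l.set i (l.get i + d)).sum = d + l.sum := by
  have hw := weight_set l i d
  rw [weight_eq, weight_eq, List.length_set] at hw
  lia

theorem set_ne_nil {l : List ℕ} (i : Fin l.length) (s : ℕ) : l.set i s ≠ [] := by
  rw [← List.length_pos_iff, List.length_set]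
  exact i.pos

theorem weight_set_lt (l : List ℕ) (i : Fin l.length) (d : ℕ) :
    weight (l.set i (l.get i + d)) < weight (d :: l) := by
  rw [weight_set, weight_cons]
  lia

theorem weight_cons_cons_lt {d a : ℕ} (ha : a < d) (l : List ℕ) :
    weight (a :: (d - 1 - a) :: l) < weight (d :: l) := by
  simp only [weight_cons]
  lia

theorem sum_cons_cons_add_one {d a : ℕ} (ha : a < d) (l : List ℕ) :
    (a :: (d - 1 - a) :: l).sum + 1 = d + l.sum := by
  simp only [List.sum_cons]
  lia

theorem normalizedB_cons_le {d : ℕ} (hd : 0 < d) {l : List ℕ} (hl : 0 ∉ l)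
    (hbound : ∀ t, t ≠ [] → weight t < weight (d :: l) → normalizedB t ≤ ((t.sum : ℝ) + 1) / 4)
    (hmin : d * (l.length + 1) ≤ d + l.sum) :
    normalizedB (d :: l) ≤ (((d :: l).sum : ℝ) + 1) / 4 := by
  have hd' : (1 : ℝ) ≤ d := mod_cast hd
  have hraise (i : Fin l.length) :
      |normalizedB (l.set i (l.get i + d)) - 0| ≤ ((d : ℝ) + l.sum + 1) / 4 := by
    rw [sub_zero, abs_of_nonneg (normalizedB_nonneg _), ← Nat.cast_add, ← sum_set_add l i d]
    exact hbound _ (set_ne_nil i _) (weight_set_lt l i d)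
  have hpair (a : ℕ) (ha : a < d) :
      |normalizedB (a :: (d - 1 - a) :: l) - 0| ≤ ((d : ℝ) + l.sum) / 4 := by
    rw [sub_zero, abs_of_nonneg (normalizedB_nonneg _), ← Nat.cast_add,
      ← sum_cons_cons_add_one ha l, Nat.cast_succ]
    exact hbound _ (List.cons_ne_nil _ _) (weight_cons_cons_lt ha l)
  have hpred : normalizedB ((d - 1) :: l) ≤ ((d : ℝ) + l.sum) / 4 := by
    have := hbound ((d - 1) :: l) (List.cons_ne_nil _ _) (by simp only [weight_cons]; lia)
    rw [List.sum_cons, Nat.cast_add, Nat.cast_pred hd] at this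
    linarith
  have hw : (weight (d :: l) : ℝ) = 2 * ((d : ℝ) + l.sum) + (l.length + 1) := by
    rw [weight_eq]; simp
  have hwl : (weight l : ℝ) = weight (d :: l) - 1 - 2 * d := by
    rw [weight_cons]; push_cast; ring
  have hquad : quadraticTerm d l ≤ d / 2 := by
    refine (quadraticTerm_le hd hl hbound hmin).trans ?_
    rw [div_le_iff₀ (by linarith)]
    nlinarith
  have havg := abs_normalizedB_cons_sub_le (by lia) hraise hpair
  rw [sub_zero, abs_of_nonneg (normalizedB_nonneg _), hwl] at havg
  refine le_of_mul_le_mul_left (havg.trans ?_) (by linarith : (0 : ℝ) < weight (d :: l) - 1)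
  rw [List.sum_cons, Nat.cast_add]
  linarith

theorem normalizedB_le {l : List ℕ} (hl : l ≠ []) : normalizedB l ≤ ((l.sum : ℝ) + 1) / 4 := by
  refine induction_on_weight (P := fun l => normalizedB l ≤ ((l.sum : ℝ) + 1) / 4)
    (fun hperm ih => ?_) ?_ (fun hne ih => ?_) (fun hd hl hmin ih => ?_) hl
  · rwa [normalizedB_perm hperm, hperm.sum_eq]
  · norm_num [normalizedB_singleton_zero]
  · rwa [normalizedB_zero_cons hne, List.sum_cons, zero_add]
  · exact normalizedB_cons_le hd hl ih hmin

/-! ### Convergence to `1 / π` -/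

/-- The shape of the bound for `|normalizedB l - 1 / π|`, with `m` the sum of the indices and `n`
their number. The term `-1 / (n * m)` makes it increase strictly in `n`, enough to absorb in the
averaging inequality the indices `a`, `d - 1 - a`, which have smaller sum and greater length. -/
noncomputable def errorBound (m n : ℝ) : ℝ := (2 - 1 / n) / m + 8 * n / m ^ 2

theorem errorBound_le_errorBound {m n n' : ℝ} (hm : 0 ≤ m) (hn : 0 < n) (h : n ≤ n') :
    errorBound m n ≤ errorBound m n' := by
  unfold errorBound
  gcongr

theorem one_div_le_errorBound {m n : ℝ} (hm : 0 ≤ m) (hn : 1 ≤ n) : 1 / m ≤ errorBound m n := by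
  have hfirst : 1 / m ≤ (2 - 1 / n) / m := by
    have : 1 / n ≤ 1 := by rw [div_le_one (by linarith)]; exact hn
    gcongr
    linarith
  have hsecond : 0 ≤ 8 * n / m ^ 2 := by positivity
  unfold errorBound
  linarith

theorem errorBound_le {m n : ℝ} (hm : 0 < m) (hn : 0 ≤ n) (hnm : n ≤ m) :
    errorBound m n ≤ 10 / m := by
  have hfirst : (2 - 1 / n) / m ≤ 2 / m := by
    have : 0 ≤ 1 / n := by positivity
    gcongr
    linarith
  have hsecond : 8 * n / m ^ 2 ≤ 8 / m := by
    rw [div_le_div_iff₀ (by positivity) hm]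
    nlinarith
  rw [errorBound, show (10 : ℝ) / m = 2 / m + 8 / m by ring]
  linarith

theorem errorBound_sub_errorBound_pred {m n : ℝ} (hm : 0 < m) (hn : 1 < n) :
    errorBound m n - errorBound m (n - 1) = 1 / (n * (n - 1) * m) + 8 / m ^ 2 := by
  have hn1 : 0 < n - 1 := by linarith
  unfold errorBound
  field_simp
  ring

theorem errorBound_pred_succ_sub {m n : ℝ} (hm : 1 < m) (hn : 1 < n) :
    errorBound (m - 1) (n + 1) - errorBound m (n - 1) =
      2 / ((n - 1) * (n + 1) * m) + (2 - 1 / (n + 1)) / (m * (m - 1))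
      + 8 * (2 / m ^ 2 + (n + 1) * ((2 * m - 1) / (m - 1) ^ 2) / m ^ 2) := by
  have hm1 : 0 < m - 1 := by linarith
  have hn1 : 0 < n - 1 := by linarith
  unfold errorBound
  field_simp
  ring

theorem errorBound_pred_succ_sub_nonneg {m n : ℝ} (hm : 1 < m) (hn : 1 < n) :
    0 ≤ errorBound (m - 1) (n + 1) - errorBound m (n - 1) := by
  have hinv : 1 / (n + 1) ≤ 1 := by rw [div_le_one (by linarith)]; linarith
  have hsecond : 0 ≤ (2 - 1 / (n + 1)) / (m * (m - 1)) := div_nonneg (by linarith) (by positivity)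
  have hthird : 0 ≤ (2 * m - 1) / (m - 1) ^ 2 := div_nonneg (by linarith) (by positivity)
  rw [errorBound_pred_succ_sub hm hn]
  positivity

theorem errorBound_pred_succ_sub_le {m n : ℝ} (hm : 40 ≤ m) (hn : 1 < n) :
    errorBound (m - 1) (n + 1) - errorBound m (n - 1) ≤
      2 / ((n - 1) * (n + 1) * m) + (181 / 10 + (n + 1) / 2) / m ^ 2 := by
  have hm1 : 0 < m - 1 := by linarith
  have hsecond : (2 - 1 / (n + 1)) / (m * (m - 1)) ≤ 21 / 10 / m ^ 2 := by
    have hinv : 0 ≤ 1 / (n + 1) := by positivity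
    rw [div_le_div_iff₀ (by positivity) (by positivity)]
    have : (2 - 1 / (n + 1)) * m ^ 2 ≤ 2 * m ^ 2 := by gcongr; linarith
    nlinarith
  have hthird : (2 * m - 1) / (m - 1) ^ 2 ≤ 1 / 16 := by
    rw [div_le_div_iff₀ (by positivity) (by norm_num)]
    nlinarith
  calc _ = 2 / ((n - 1) * (n + 1) * m) + (2 - 1 / (n + 1)) / (m * (m - 1))
          + 8 * (2 / m ^ 2 + (n + 1) * ((2 * m - 1) / (m - 1) ^ 2) / m ^ 2) :=
        errorBound_pred_succ_sub (by linarith) hn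
    _ ≤ 2 / ((n - 1) * (n + 1) * m) + 21 / 10 / m ^ 2
          + 8 * (2 / m ^ 2 + (n + 1) * (1 / 16) / m ^ 2) := by gcongr
    _ = _ := by ring

theorem errorBound_pred_add_le {m n w : ℝ} (hm : 40 ≤ m) (hn : 2 ≤ n) (hw : w ≤ 1 / n) :
    errorBound m (n - 1) + w * (errorBound (m - 1) (n + 1) - errorBound m (n - 1)) + 1 / m ^ 2 ≤
      errorBound m n := by
  have hn1 : 0 < n - 1 := by linarith
  have hloss : w * (errorBound (m - 1) (n + 1) - errorBound m (n - 1)) ≤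
      1 / n * (2 / ((n - 1) * (n + 1) * m) + (181 / 10 + (n + 1) / 2) / m ^ 2) := by
    refine mul_le_mul hw (errorBound_pred_succ_sub_le hm (by linarith)) ?_ (by positivity)
    exact errorBound_pred_succ_sub_nonneg (by linarith) (by linarith)
  have hmargin : 1 / (n * (n - 1) * m) + 8 / m ^ 2
      - (1 / n * (2 / ((n - 1) * (n + 1) * m) + (181 / 10 + (n + 1) / 2) / m ^ 2) + 1 / m ^ 2) =
      (m / (n + 1) + 13 / 2 * n - 186 / 10) / (n * m ^ 2) := by
    field_simp
    ring
  have hmargin_nonneg : 0 ≤ (m / (n + 1) + 13 / 2 * n - 186 / 10) / (n * m ^ 2) := by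
    refine div_nonneg ?_ (by positivity)
    rcases le_total n 3 with h3 | h3
    · have : 10 ≤ m / (n + 1) := by rw [le_div_iff₀ (by linarith)]; linarith
      linarith
    · have : 0 ≤ m / (n + 1) := by positivity
      linarith
  linarith [errorBound_sub_errorBound_pred (by linarith : 0 < m) (by linarith : 1 < n)]

theorem average_errorBound_le {m n d : ℝ} (hm : 40 ≤ m) (hn : 2 ≤ n) (hd : d * n ≤ m) :
    (2 * m + n - 1 - 2 * d) * errorBound m (n - 1) + 2 * d * errorBound (m - 1) (n + 1)
      + (2 * m + n - 1) * (1 / m ^ 2) ≤ (2 * m + n - 1) * errorBound m n := by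
  have hpos : 0 < 2 * m + n - 1 := by linarith
  have hw : 2 * d / (2 * m + n - 1) ≤ 1 / n := by
    rw [div_le_div_iff₀ hpos (by linarith)]
    linarith
  calc _ = (2 * m + n - 1) * (errorBound m (n - 1)
          + 2 * d / (2 * m + n - 1) * (errorBound (m - 1) (n + 1) - errorBound m (n - 1))
          + 1 / m ^ 2) := by
        field_simp
        ring
    _ ≤ _ := by
        gcongr
        exact errorBound_pred_add_le hm hn hw

theorem quadraticTerm_le_of_normalizedB_pred_le {d : ℕ} (hd : 0 < d) {l : List ℕ} (hl : 0 ∉ l)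
    (hmin : d * (l.length + 1) ≤ d + l.sum) {M : ℝ} (hM : normalizedB ((d - 1) :: l) ≤ M) :
    quadraticTerm d l ≤
      ((weight (d :: l) : ℝ) - 1) * ((M / 2 + 1 / 4) * (1 / ((d : ℝ) + l.sum) ^ 2)) := by
  have hw : (weight (d :: l) : ℝ) = 2 * ((d : ℝ) + l.sum) + (l.length + 1) := by
    rw [weight_eq]; simp
  have hm : (1 : ℝ) ≤ d + l.sum := mod_cast (by lia)
  have hM0 : 0 ≤ M := (normalizedB_nonneg _).trans hM
  set m : ℝ := d + l.sum
  have hone : 1 ≤ ((weight (d :: l) : ℝ) - 1) * (1 / m ^ 2) * (weight (d :: l) - 2) := by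
    rw [mul_one_div, div_mul_eq_mul_div, le_div_iff₀ (by positivity), hw]
    nlinarith
  calc quadraticTerm d l ≤ (normalizedB ((d - 1) :: l) / 2 + 1 / 4) / (weight (d :: l) - 2) :=
        quadraticTerm_le hd hl (fun _ ht _ => normalizedB_le ht) hmin
    _ ≤ (M / 2 + 1 / 4) / (weight (d :: l) - 2) := by
        gcongr
        linarith
    _ ≤ _ := by
        rw [div_le_iff₀ (by linarith)]
        nlinarith

theorem normalizedB_pred_cons_le {d : ℕ} (hd : 0 < d) {l : List ℕ} (hm : 40 ≤ d + l.sum)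
    (hlen : l.length < d + l.sum)
    (ih : |normalizedB ((d - 1) :: l) - 1 / π| ≤
      1000 * errorBound (((d - 1) :: l).sum : ℕ) (((d - 1) :: l).length : ℕ)) :
    normalizedB ((d - 1) :: l) ≤ 1001 := by
  have hm' : (40 : ℝ) ≤ d + l.sum := mod_cast hm
  have hlen' : (l.length : ℝ) + 1 ≤ d + l.sum := mod_cast hlen
  have herr : errorBound ((d : ℝ) + l.sum - 1) (l.length + 1) ≤ 1 := by
    have hfirst : (2 - 1 / ((l.length : ℝ) + 1)) / (d + l.sum - 1) ≤ 2 / 39 := by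
      have : 0 ≤ 1 / ((l.length : ℝ) + 1) := by positivity
      exact div_le_div₀ (by norm_num) (by linarith) (by norm_num) (by linarith)
    have hsecond : 8 * ((l.length : ℝ) + 1) / (d + l.sum - 1) ^ 2 ≤ 1 / 2 := by
      rw [div_le_div_iff₀ (by nlinarith) (by norm_num)]
      nlinarith
    rw [errorBound]
    linarith
  rw [List.sum_cons, List.length_cons, Nat.cast_add, Nat.cast_pred hd, Nat.cast_succ,
    sub_add_eq_add_sub] at ih
  linarith [(abs_le.1 ih).2, one_div_pi_le_one]

theorem abs_normalizedB_cons_sub_le_errorBound {d : ℕ} (hd : 0 < d) {l : List ℕ} (hl : 0 ∉ l)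
    (hne : l ≠ []) (hm : 40 ≤ d + l.sum) (hmin : d * (l.length + 1) ≤ d + l.sum)
    (ih : ∀ t, t ≠ [] → weight t < weight (d :: l) → 0 < t.sum →
      |normalizedB t - 1 / π| ≤ 1000 * errorBound t.sum t.length) :
    |normalizedB (d :: l) - 1 / π| ≤ 1000 * errorBound (d :: l).sum (d :: l).length := by
  have hlen := List.length_pos_iff.2 hne
  have hw : (weight (d :: l) : ℝ) = 2 * ((d : ℝ) + l.sum) + (l.length + 1) := by
    rw [weight_eq]; simp
  have hwl : (weight l : ℝ) = weight (d :: l) - 1 - 2 * d := by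
    rw [weight_cons]; push_cast; ring
  have hm' : (40 : ℝ) ≤ d + l.sum := mod_cast hm
  have hn' : (2 : ℝ) ≤ (l.length : ℝ) + 1 := mod_cast (by lia)
  have hraise (i : Fin l.length) : |normalizedB (l.set i (l.get i + d)) - 1 / π| ≤
      1000 * errorBound (d + l.sum) (l.length + 1 - 1) := by
    have := ih _ (set_ne_nil i _) (weight_set_lt l i d) (by rw [sum_set_add]; lia)
    rwa [sum_set_add, List.length_set, Nat.cast_add, ← add_sub_cancel_right (l.length : ℝ) 1]
      at this
  have hpair (a : ℕ) (ha : a < d) : |normalizedB (a :: (d - 1 - a) :: l) - 1 / π| ≤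
      1000 * errorBound (d + l.sum - 1) (l.length + 1 + 1) := by
    have hsum := sum_cons_cons_add_one ha l
    have := ih _ (List.cons_ne_nil _ _) (weight_cons_cons_lt ha l) (by lia)
    rw [← Nat.cast_add, ← hsum, Nat.cast_succ, add_sub_cancel_right]
    exact_mod_cast this
  have hpred : normalizedB ((d - 1) :: l) ≤ 1001 := by
    refine normalizedB_pred_cons_le hd hm (by nlinarith) (ih _ (List.cons_ne_nil _ _) ?_ ?_)
    · simp only [weight_cons]; lia
    · rw [List.sum_cons]; lia
  have hquad := quadraticTerm_le_of_normalizedB_pred_le hd hl hmin hpred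
  have havg := abs_normalizedB_cons_sub_le (by lia) hraise hpair
  have hstep := average_errorBound_le hm' hn' (d := d) (mod_cast hmin)
  rw [hwl] at havg
  rw [hw] at havg hquad
  have hpos : (0 : ℝ) < 2 * ((d : ℝ) + l.sum) + (l.length + 1) - 1 := by linarith
  have hsq := mul_nonneg hpos.le (by positivity : 0 ≤ 1 / ((d : ℝ) + l.sum) ^ 2)
  rw [List.sum_cons, List.length_cons, Nat.cast_add, Nat.cast_succ]
  refine le_of_mul_le_mul_left (havg.trans ?_) hpos
  linarith

theorem abs_normalizedB_sub_le_of_sum_le {l : List ℕ} (hl : l ≠ []) (hsum : 0 < l.sum)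
    (hsum' : l.sum ≤ 40) : |normalizedB l - 1 / π| ≤ 1000 * (1 / (l.sum : ℝ)) := by
  have hm : (l.sum : ℝ) ≤ 40 := mod_cast hsum'
  have hinv : 1 / 40 ≤ 1 / (l.sum : ℝ) := one_div_le_one_div_of_le (mod_cast hsum) hm
  have hpi : 0 ≤ 1 / π := by positivity
  rw [abs_le]
  constructor <;> linarith [normalizedB_le hl, normalizedB_nonneg l, one_div_pi_le_one]

theorem abs_normalizedB_sub_le_errorBound {l : List ℕ} (hl : l ≠ []) (hsum : 0 < l.sum) :
    |normalizedB l - 1 / π| ≤ 1000 * errorBound l.sum l.length := by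
  refine induction_on_weight (P := fun l => 0 < l.sum →
    |normalizedB l - 1 / π| ≤ 1000 * errorBound l.sum l.length)
    (fun hperm ih => ?_) (fun h => absurd h (by simp)) (fun {t} hne ih hsum => ?_)
    (fun {d t} hd ht hmin ih _ => ?_) hl hsum
  · rwa [normalizedB_perm hperm, hperm.sum_eq, hperm.length_eq]
  · rw [List.sum_cons, zero_add] at hsum
    rw [normalizedB_zero_cons hne, List.sum_cons, zero_add]
    refine (ih hsum).trans (mul_le_mul_of_nonneg_left ?_ (by norm_num))
    refine errorBound_le_errorBound (Nat.cast_nonneg _) ?_ ?_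
    · exact_mod_cast List.length_pos_iff.2 hne
    · simp
  · have hpos : (0 : ℝ) < ((d :: t).sum : ℕ) := by rw [List.sum_cons]; exact_mod_cast (by lia)
    have herr : 1 / (((d :: t).sum : ℕ) : ℝ) ≤ errorBound (d :: t).sum (d :: t).length :=
      one_div_le_errorBound hpos.le (by simp)
    rcases le_or_gt (d + t.sum) 40 with hsmall | hlarge
    · rw [← List.sum_cons] at hsmall
      have := abs_normalizedB_sub_le_of_sum_le (List.cons_ne_nil d t) (mod_cast hpos) hsmall
      linarith
    rcases eq_or_ne t [] with rfl | hne
    · have : 1 / ((d : ℝ) + 1) ≤ 1 / d :=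
        one_div_le_one_div_of_le (mod_cast hd) (by linarith)
      have hnonneg : 0 ≤ 1 / (d : ℝ) := by positivity
      rw [List.sum_singleton] at herr ⊢
      linarith [abs_normalizedB_singleton_sub_le d]
    · exact abs_normalizedB_cons_sub_le_errorBound hd ht hne hlarge.le hmin ih

theorem abs_normalizedB_sub_le {l : List ℕ} (hl : l ≠ []) :
    |normalizedB l - 1 / π| ≤ 20000 / ((l.sum : ℝ) + 1) := by
  refine induction_on_weight (P := fun l => |normalizedB l - 1 / π| ≤ 20000 / ((l.sum : ℝ) + 1))
    (fun hperm ih => ?_) ?_ (fun hne ih => ?_) (fun {d t} hd ht _ _ => ?_) hl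
  · rwa [normalizedB_perm hperm, hperm.sum_eq]
  · have : 0 ≤ 1 / π := by positivity
    rw [normalizedB_singleton_zero, List.sum_singleton, Nat.cast_zero, zero_add, div_one, abs_le]
    constructor <;> linarith [one_div_pi_le_one]
  · rwa [normalizedB_zero_cons hne, List.sum_cons, zero_add]
  · have hzero : 0 ∉ d :: t := by simp [hd.ne, ht]
    have hlen : (d :: t).length ≤ (d :: t).sum :=
      List.length_le_sum_of_one_le _ fun s hs => Nat.pos_of_ne_zero (ne_of_mem_of_not_mem hs hzero)
    have hsum : 0 < (d :: t).sum := by rw [List.sum_cons]; lia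
    have hm : (1 : ℝ) ≤ ((d :: t).sum : ℕ) := mod_cast hsum
    calc |normalizedB (d :: t) - 1 / π| ≤ 1000 * errorBound (d :: t).sum (d :: t).length :=
          abs_normalizedB_sub_le_errorBound (List.cons_ne_nil d t) hsum
      _ ≤ 1000 * (10 / ((d :: t).sum : ℕ)) := by
          gcongr
          exact errorBound_le (by linarith) (Nat.cast_nonneg _) (mod_cast hlen)
      _ ≤ 20000 / (((d :: t).sum : ℕ) + 1) := by
          rw [← mul_div_assoc, div_le_div_iff₀ (by linarith) (by linarith)]
          linarith

theorem C_eq_normalizedB {n : ℕ} (d : Fin n → ℕ) : (C d : ℝ) = normalizedB (List.ofFn d) := by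
  have hX : X d = weight (List.ofFn d) := by
    rw [X, weight, List.map_ofFn, List.sum_ofFn]
    rfl
  have hg : 2 * genus d - 1 = 2 * (List.ofFn d).sum + 1 := by
    rw [genus, List.sum_ofFn]
    lia
  have hprod : (∏ j, (((2 * d j + 1)‼ : ℕ) : ℝ)) ≠ 0 :=
    Finset.prod_ne_zero_iff.2 fun j _ => mod_cast (Nat.doubleFactorial_pos _).ne'
  rw [C, bgwNumber, hX, hg, normalizedB]
  push_cast
  field_simp

end BGW

theorem theorem1p1 :
    ∃ K : ℝ, ∀ (n : ℕ), 1 ≤ n → ∀ d : Fin n → ℕ,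
      |(BGW.C d : ℝ) - 1 / Real.pi| ≤ K / (BGW.genus d : ℝ) := by
  refine ⟨20000, fun n hn d => ?_⟩
  have hne : List.ofFn d ≠ [] := by rwa [← List.length_pos_iff, List.length_ofFn]
  rw [BGW.C_eq_normalizedB, BGW.genus, ← List.sum_ofFn, Nat.cast_succ]
  exact BGW.abs_normalizedB_sub_le hne
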